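/- There exists a polynomial $f$ with real coefficients such that the following holds for all integers $\ell \ge 3$ and all integers $n \ge 0$ with $n \ge f(\ell)$. Let $G$ be a finite simple graph on $2n+1$ vertices with at least $n^2+n$ edges in which no two distinct vertices of equal degree are joined by a path of length $2\ell+1$ (a path with $2\ell+1$ edges and no repeated vertices, not necessarily induced). Then $G$ has exactly $n^2+n$ edges and is isomorphic to the complete bipartite graph $K_{n,n+1}$. Conversely, $K_{n,n+1}$ has exactly $n^2+n$ edges and no two distinct vertices of equal degree in it are joined by a path of length $2\ell+1$; so $K_{n,n+1}$ is the unique extremal graph. -/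

import Mathlib

/-- No two distinct vertices of `G` that have the same degree are joined by a path
(no repeated vertices, not necessarily induced) with exactly `k` edges. -/
def EqualDegreePathFree {V : Type*} [Fintype V] (G : SimpleGraph V) [DecidableRel G.Adj]
    (k : ℕ) : Prop :=
  ∀ u v : V, u ≠ v → G.degree u = G.degree v → ∀ p : G.Walk u v, p.IsPath → p.length ≠ k

/-!
Write `N = 2 * n + 1` and suppose that `G` has at least `n ^ 2 + n` edges, that is, degree sum at
least `(N ^ 2 - 1) / 2`, and no path of length `2 * ℓ + 1` between two vertices of equal degree.
A bipartite graph on `N` vertices has at most `n ^ 2 + n` edges, with equality only for `K_{n,n+1}`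
(`iso_completeBipartiteGraph_of_bipartition`), so it has to be shown that `G` is bipartite. The
difficulty is that another graph attains the same number of edges: the antiregular ("half") graph,
in which only two vertices share a degree. Both structures have to be treated exactly, and
everything else excluded by an approximate count (`injOn_degree_or_nearly_complete`).

*The approximate count.* Let `v` have maximum degree `D`. Discarding few edges, pass to `A ⊆ N(v)`
and `X ⊆ V \ {v}` such that every vertex of `A` has many neighbours in `X` and vice versa
(`exists_core`). From a vertex of `A` one can zigzag between `A` and `X` for any even number of
steps and then reach any other vertex of `A` through `v`; hence one edge inside `A`, in the right
place, yields a path of odd length. Consequently a vertex of `A` whose degree is repeated in `A` has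
at most one neighbour in `A`, and the vertices at distance two from it are restricted in a similar
way (`IsCore.degree_le_of_mem_representatives`). Choose a set `P ⊆ A` of representatives of the
degrees occurring in `A`. The degrees in `P` are distinct, the degrees in `A \ P` are at most
`N - |A| + 1`, and all others are at most `D`. An optimization over `|P|`, `|A \ P|` and `D`
(`stability_inequality`) leaves only two possibilities: `P` contains almost all vertices, or the
edges between `A \ P` and the complement of `A` are almost `N ^ 2 / 4` in number.

*Almost all degrees distinct.* Then the number of vertices of degree at least `(1 - θ) N` is about
`θ N`, so any two vertices with three neighbours of degree at least `N / 20` are joined by a path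
of length `2 * ℓ + 1` through vertices of almost full degree. Such vertices therefore have distinct
degrees, the remaining ones have small degree, and the degree sum is too small
(`not_equalDegreePathFree_of_injOn_degree`).

*Nearly complete bipartite.* Many vertices on one side have the same degree, and any edge or vertex
violating bipartiteness yields an odd path between two of them. The vertices with many neighbours
on neither side would cost too many edges, so there are none
(`exists_bipartition_of_nearly_complete`).
-/

/-! ### Paths avoiding a set of vertices -/

/-- `G` has a path with exactly `m` edges from `u` to `w` none of whose vertices lies in `F`. -/
def PathAvoiding {V : Type*} (G : SimpleGraph V) (F : Finset V) (m : ℕ) (u w : V) : Prop :=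
  ∃ p : G.Walk u w, p.IsPath ∧ p.length = m ∧ ∀ z ∈ p.support, z ∉ F

section Paths

variable {V : Type*} {G : SimpleGraph V}

theorem PathAvoiding.edge {F : Finset V} {u w : V} (h : G.Adj u w) (hu : u ∉ F) (hw : w ∉ F) :
    PathAvoiding G F 1 u w := by
  refine ⟨h.toWalk, ?_, by simp, ?_⟩
  · simpa using h.ne
  · simp [hu, hw]

variable [DecidableEq V]

/-- Paths are built greedily from their first vertex, which is then forbidden for the rest. -/
theorem PathAvoiding.cons {F : Finset V} {m : ℕ} {u x w : V} (h : G.Adj u x) (hu : u ∉ F)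
    (hp : PathAvoiding G (insert u F) m x w) : PathAvoiding G F (m + 1) u w := by
  obtain ⟨p, hp, hl, hF⟩ := hp
  refine ⟨SimpleGraph.Walk.cons h p, ?_, by simp [hl], ?_⟩
  · rw [SimpleGraph.Walk.cons_isPath_iff]
    exact ⟨hp, fun hmem => hF u hmem (Finset.mem_insert_self _ _)⟩
  · intro z hz
    rw [SimpleGraph.Walk.support_cons, List.mem_cons] at hz
    rcases hz with rfl | hz
    · exact hu
    · exact fun hzF => hF z hz (Finset.mem_insert_of_mem hzF)

theorem PathAvoiding.concat {F : Finset V} {m : ℕ} {u x w : V}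
    (hp : PathAvoiding G (insert w F) m u x) (h : G.Adj x w) (hw : w ∉ F) :
    PathAvoiding G F (m + 1) u w := by
  obtain ⟨p, hp, hl, hF⟩ := hp
  refine ⟨p.concat h, hp.concat (fun hmem => hF w hmem (Finset.mem_insert_self _ _)) h,
    by simp [hl], ?_⟩
  intro z hz
  rw [SimpleGraph.Walk.support_concat] at hz
  simp only [List.mem_append, List.mem_singleton] at hz
  rcases hz with hz | rfl
  · exact fun hzF => hF z hz (Finset.mem_insert_of_mem hzF)
  · exact hw

theorem PathAvoiding.two {F : Finset V} {u x w : V} (h : G.Adj u x) (h' : G.Adj x w)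
    (hu : u ∉ F) (hx : x ∉ F) (hw : w ∉ F) (huw : w ≠ u) :
    PathAvoiding G F 2 u w :=
  .cons h hu (.edge h' (by simp [hx, h.ne']) (by simp [hw, huw]))

theorem EqualDegreePathFree.degree_ne {V : Type*} [Fintype V] {G : SimpleGraph V}
    [DecidableRel G.Adj] {k : ℕ} (hG : EqualDegreePathFree G k) {F : Finset V} {u w : V}
    (huw : u ≠ w) (hp : PathAvoiding G F k u w) : G.degree u ≠ G.degree w := by
  obtain ⟨p, hp, hl, -⟩ := hp
  exact fun h => hG u w huw h p hp hl

theorem exists_mem_notMem_insert {S F : Finset V} {a : V} (h : F.card + 1 < S.card) :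
    ∃ x ∈ S, x ≠ a ∧ x ∉ F := by
  obtain ⟨x, hx, hx'⟩ := Finset.exists_mem_notMem_of_card_lt_card
    ((Finset.card_insert_le a F).trans_lt h)
  simp only [Finset.mem_insert, not_or] at hx'
  exact ⟨x, hx, hx'⟩

theorem exists_mem_notMem_insert₂ {S F : Finset V} {a b : V} (h : F.card + 2 < S.card) :
    ∃ x ∈ S, x ≠ a ∧ x ≠ b ∧ x ∉ F := by
  obtain ⟨x, hx, hx', hx''⟩ := exists_mem_notMem_insert (S := S) (F := insert b F) (a := a)
    (by have := Finset.card_insert_le b F; omega)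
  simp only [Finset.mem_insert, not_or] at hx''
  exact ⟨x, hx, hx', hx''⟩

theorem exists_mem_notMem_insert₃ {S F : Finset V} {a b c : V} (h : F.card + 3 < S.card) :
    ∃ x ∈ S, x ≠ a ∧ x ≠ b ∧ x ≠ c ∧ x ∉ F := by
  obtain ⟨x, hx, hx', hx'', hx3⟩ := exists_mem_notMem_insert₂ (S := S) (F := insert c F) (a := a)
    (b := b) (by have := Finset.card_insert_le c F; omega)
  simp only [Finset.mem_insert, not_or] at hx3
  exact ⟨x, hx, hx', hx'', hx3⟩

end Paths

/-! ### Sums of distinct degrees and double counting -/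

section Sums

variable {V : Type*}

theorem card_mul_card_le_sum_id (T : Finset ℕ) : T.card * T.card ≤ 2 * ∑ i ∈ T, i + T.card := by
  induction T using Finset.induction_on_max with
  | empty => simp
  | insert m T hm ih =>
    have hmT : m ∉ T := fun h => (hm m h).false
    have hc : T.card ≤ m := by
      simpa using Finset.card_le_card (fun x hx => Finset.mem_range.2 (hm x hx) : T ⊆ Finset.range m)
    rw [Finset.sum_insert hmT, Finset.card_insert_of_notMem hmT]
    nlinarith

theorem card_mul_card_le_sum_of_injOn {S : Finset V} {f : V → ℕ} (hf : Set.InjOn f S) :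
    S.card * S.card ≤ 2 * ∑ z ∈ S, f z + S.card := by
  have h := card_mul_card_le_sum_id (S.image f)
  rwa [Finset.sum_image hf, Finset.card_image_of_injOn hf] at h

/-- Distinct values at most `M` sum to at most `M + (M - 1) + ⋯`. -/
theorem sum_le_of_injOn {S : Finset V} {f : V → ℕ} {M : ℕ} (hf : Set.InjOn f S)
    (hM : ∀ z ∈ S, f z ≤ M) :
    2 * ∑ z ∈ S, f z + S.card * S.card ≤ 2 * (S.card * M) + S.card := by
  have h := card_mul_card_le_sum_of_injOn (S := S) (f := fun z => M - f z) (by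
    intro a ha b hb hab
    have := hM a ha
    have := hM b hb
    refine hf ha hb ?_
    simp only at hab
    omega)
  have h2 : ∑ z ∈ S, (M - f z) + ∑ z ∈ S, f z = S.card * M := by
    rw [← Finset.sum_add_distrib, Finset.sum_congr rfl (fun z hz => Nat.sub_add_cancel (hM z hz))]
    simp
  omega

end Sums

section Counting

variable {V : Type*} [Fintype V] [DecidableEq V] {G : SimpleGraph V} [DecidableRel G.Adj]

theorem degree_add_degree_le (y h : V) :
    G.degree y + G.degree h ≤
      (G.neighborFinset y ∩ G.neighborFinset h).card + Fintype.card V := by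
  have h1 := Finset.card_union_add_card_inter (G.neighborFinset y) (G.neighborFinset h)
  have h2 := Finset.card_le_univ (G.neighborFinset y ∪ G.neighborFinset h)
  simp only [SimpleGraph.card_neighborFinset_eq_degree] at h1
  omega

theorem card_inter_add_card_inter_compl (z : V) (S : Finset V) :
    (G.neighborFinset z ∩ S).card + (G.neighborFinset z ∩ Sᶜ).card = G.degree z := by
  rw [← G.card_neighborFinset_eq_degree, ← Finset.sdiff_eq_inter_compl]
  exact Finset.card_inter_add_card_sdiff _ _

/-- Double counting of the edges between two sets of vertices. -/
theorem sum_card_neighborFinset_inter_comm (S T : Finset V) :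
    ∑ z ∈ S, (G.neighborFinset z ∩ T).card = ∑ z ∈ T, (G.neighborFinset z ∩ S).card := by
  have h : ∀ (z : V) (U : Finset V), G.neighborFinset z ∩ U = U.bipartiteAbove G.Adj z := by
    intro z U
    ext y
    simp [Finset.bipartiteAbove, and_comm]
  simp only [h]
  rw [Finset.sum_card_bipartiteAbove_eq_sum_card_bipartiteBelow]
  refine Finset.sum_congr rfl fun z _ => ?_
  simp only [Finset.bipartiteAbove, Finset.bipartiteBelow, G.adj_comm]

end Counting

/-! ### Graphs in which almost all degrees are distinct -/

section HalfGraph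

variable {V : Type*} [Fintype V] [DecidableEq V] {G : SimpleGraph V} [DecidableRel G.Adj]

/-- Two vertices of degree at least `39 N / 40` have many common neighbours, which gives the even
steps. The parity is changed by one edge from such a vertex to a vertex of degree at least
`191 N / 200`: there are more of the latter than a vertex of degree `39 N / 40` can miss, and
each of them still has common neighbours with every vertex of degree `N / 20`. -/
theorem pathAvoiding_of_high_degree
    (h1 : Fintype.card V ≤ 45 * (Finset.univ.filter fun z =>
      39 * Fintype.card V ≤ 40 * G.degree z).card)
    (h2 : 43 * Fintype.card V ≤ 1000 * (Finset.univ.filter fun z =>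
      191 * Fintype.card V ≤ 200 * G.degree z).card)
    {y : V} (hy : Fintype.card V ≤ 20 * G.degree y) (j : ℕ) {F : Finset V} {h : V}
    (hh : 39 * Fintype.card V ≤ 40 * G.degree h) (hF : h ∉ F) (hyF : y ∉ F) (hhy : h ≠ y)
    (hcard : 1000 * (F.card + 2 * j + 10) ≤ Fintype.card V) :
    PathAvoiding G F (2 * j + 3) h y := by
  induction j generalizing F h with
  | zero =>
    set H := Finset.univ.filter fun z => 191 * Fintype.card V ≤ 200 * G.degree z with hH
    have hi := Finset.card_union_add_card_inter (G.neighborFinset h) H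
    have hu := Finset.card_le_univ (G.neighborFinset h ∪ H)
    rw [G.card_neighborFinset_eq_degree] at hi
    obtain ⟨h', hh', h'y, h'h, h'F⟩ := exists_mem_notMem_insert₂
      (S := G.neighborFinset h ∩ H) (F := F) (a := y) (b := h) (by omega)
    rw [Finset.mem_inter, G.mem_neighborFinset, hH, Finset.mem_filter] at hh'
    have hc := degree_add_degree_le (G := G) h' y
    obtain ⟨c, hc, cy, ch', ch, cF⟩ := exists_mem_notMem_insert₃
      (S := G.neighborFinset h' ∩ G.neighborFinset y) (F := F) (a := y) (b := h') (c := h)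
      (by omega)
    rw [Finset.mem_inter, G.mem_neighborFinset, G.mem_neighborFinset] at hc
    exact .cons hh'.1 hF (.two hc.1 hc.2.symm (by simp [h'h, h'F]) (by simp [ch, cF])
      (by simp [hhy.symm, hyF]) h'y.symm)
  | succ j ih =>
    obtain ⟨h', hh', h'y, h'h, h'F⟩ := exists_mem_notMem_insert₂
      (S := Finset.univ.filter fun z => 39 * Fintype.card V ≤ 40 * G.degree z)
      (F := F) (a := y) (b := h) (by omega)
    rw [Finset.mem_filter] at hh'
    have hc := degree_add_degree_le (G := G) h h'
    obtain ⟨c, hc, cy, ch', ch, cF⟩ := exists_mem_notMem_insert₃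
      (S := G.neighborFinset h ∩ G.neighborFinset h') (F := F) (a := y) (b := h') (c := h)
      (by omega)
    rw [Finset.mem_inter, G.mem_neighborFinset, G.mem_neighborFinset] at hc
    have hc1 := Finset.card_insert_le h F
    have hc2 := Finset.card_insert_le c (insert h F)
    exact .cons hc.1 hF (.cons hc.2.symm (by simp [ch, cF]) (ih hh'.2
      (by simp [ch'.symm, h'h, h'F]) (by simp [cy.symm, hhy.symm, hyF]) h'y (by omega)))

/-- The path leaves `z` and `z'` through neighbours `y` and `y'` of degree at least `N / 20`, and
continues from `y` through a common neighbour with a vertex of almost full degree. Three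
neighbours leave room to choose `y` and `y'` distinct from each other and from `z` and `z'`. -/
theorem pathAvoiding_of_many_neighbors
    (h1 : Fintype.card V ≤ 45 * (Finset.univ.filter fun z =>
      39 * Fintype.card V ≤ 40 * G.degree z).card)
    (h2 : 43 * Fintype.card V ≤ 1000 * (Finset.univ.filter fun z =>
      191 * Fintype.card V ≤ 200 * G.degree z).card)
    {z z' : V} (hzz' : z ≠ z')
    (hz : 3 ≤ (G.neighborFinset z ∩ Finset.univ.filter fun z =>
      Fintype.card V ≤ 20 * G.degree z).card)
    (hz' : 3 ≤ (G.neighborFinset z' ∩ Finset.univ.filter fun z =>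
      Fintype.card V ≤ 20 * G.degree z).card)
    (j : ℕ) (hcard : 1000 * (2 * j + 20) ≤ Fintype.card V) :
    PathAvoiding G ∅ (2 * j + 7) z z' := by
  obtain ⟨y, hy, yz', -⟩ := exists_mem_notMem_insert (F := ∅) (a := z')
    (lt_of_lt_of_le (by simp) hz)
  obtain ⟨y', hy', y'z, y'y, -⟩ := exists_mem_notMem_insert₂ (F := ∅) (a := z) (b := y)
    (lt_of_lt_of_le (by simp) hz')
  rw [Finset.mem_inter, G.mem_neighborFinset, Finset.mem_filter] at hy hy'
  obtain ⟨h, hh, hhy, hhy', hhz', hhz⟩ := exists_mem_notMem_insert₃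
      (S := Finset.univ.filter fun z => 39 * Fintype.card V ≤ 40 * G.degree z)
      (F := {z}) (a := y) (b := y') (c := z') (by rw [Finset.card_singleton]; omega)
  rw [Finset.mem_filter] at hh
  have hc := degree_add_degree_le (G := G) y h
  obtain ⟨c, hc, cy, cy', ch, cF⟩ := exists_mem_notMem_insert₃
      (S := G.neighborFinset y ∩ G.neighborFinset h) (F := {z, z'}) (a := y) (b := y') (c := h)
      (by have := Finset.card_le_two (a := z) (b := z'); omega)
  rw [Finset.mem_inter, G.mem_neighborFinset, G.mem_neighborFinset] at hc
  simp only [Finset.mem_insert, Finset.mem_singleton, not_or] at cF hhz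
  have key := pathAvoiding_of_high_degree h1 h2 hy'.2.2 j (F := {z', z, y, c}) hh.2
    (by simp [hhz', hhz, hhy, ch.symm]) (by simp [hy'.1.ne', y'z, y'y, cy'.symm]) hhy'
    (by have := Finset.card_le_four (a := z') (b := z) (c := y) (d := c); omega)
  have key2 : PathAvoiding G {z', z} (2 * j + 5) y y' := .cons hc.1
    (by simp [yz', hy.1.ne'])
    (.cons hc.2.symm (by simp [cy, cF]) (by
      convert key using 1
      ext x; simp; tauto))
  exact .concat (.cons hy.1 (by simp [hzz']) (by rwa [Finset.pair_comm] at key2)) hy'.1.symm (by simp)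

/-- At most `b` vertices of `P` have degree less than `b`, as these degrees are distinct. -/
theorem card_le_card_filter_le_degree {P : Finset V} (hP : Set.InjOn (fun z => G.degree z) P)
    (b : ℕ) : Fintype.card V ≤
      (Finset.univ.filter fun z => b ≤ G.degree z).card + b + (Fintype.card V - P.card) := by
  have h1 : (P.filter fun z => G.degree z < b).card ≤ b := by
    have := Finset.card_le_card_of_injOn (s := P.filter fun z => G.degree z < b)
      (t := Finset.range b) (fun z => G.degree z) (by intro z hz; simp at hz ⊢; exact hz.2)
      (hP.mono (by intro z hz; simp at hz; exact hz.1))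
    simpa using this
  have h2 : P ⊆ (P.filter fun z => G.degree z < b) ∪
      Finset.univ.filter fun z => b ≤ G.degree z := by
    intro z hz
    simp [hz, lt_or_ge]
  have h3 := (Finset.card_le_card h2).trans (Finset.card_union_le _ _)
  have := Finset.card_le_univ P
  omega

/-- The function `l ↦ l * (2 * s + 1 - l)` on integers is maximal at `l = s` and `l = s + 1`. -/
theorem mul_pred_bound {x l s : ℕ} (h : 2 * x + l * l ≤ 2 * (l * s) + l) (hl : l ≤ s + 1) :
    2 * x ≤ (s + 1) * s := by
  rcases hl.lt_or_eq with hl | rfl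
  · obtain ⟨d, rfl⟩ : ∃ d, s = l + d := ⟨s - l, by omega⟩
    nlinarith [Nat.zero_le (d * d)]
  · nlinarith

/-- The final count, with `s + 1 = |S|`, `r = |Sᶜ|`, `t = |T|` for the set `S` of well-connected
vertices and the set `T` of vertices in `S` of degree greater than `s`. The number of edges forces
`t > 0.92 r`, whereas the few edges between `T` and `Sᶜ` force `t * (t + 1) ≤ 4 * r`. -/
theorem false_of_degree_sum_bounds {N r s t m x low R : ℕ} (hrs : r + (s + 1) = N)
    (hedge : N * N ≤ 2 * (R + (x + t * s + low)) + 1) (hx : x ≤ 2 * r) (ht : t * t + t ≤ 4 * r)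
    (hlow : 2 * low ≤ (s + 1) * s) (hR : R ≤ 2 * r + r * m) (hm : 100 * m ≤ 7 * s)
    (hs : 600 ≤ s) : False := by
  have hquad : r * r + 2 * (r * s) + s ≤ 6 * r + 2 * (r * m) + 2 * (t * s) := by
    rw [← hrs] at hedge
    have e : (r + (s + 1)) * (r + (s + 1)) =
        r * r + 2 * (r * s) + 2 * r + (s + 1) * s + s + 1 := by ring
    omega
  have hrm : 100 * (r * m) ≤ 7 * (r * s) := by
    have := Nat.mul_le_mul_left r hm
    linarith
  have hr6 : 600 * r ≤ r * s := by
    have := Nat.mul_le_mul_left r hs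
    linarith
  have hlin : 185 * r + 100 ≤ 200 * t := by
    refine Nat.le_of_mul_le_mul_right (c := s) ?_ (by omega)
    have e1 : (185 * r + 100) * s = 185 * (r * s) + 100 * s := by ring
    have e2 : 200 * t * s = 200 * (t * s) := by ring
    have := Nat.zero_le (r * r)
    omega
  -- if `t ≤ r` then `7 ≤ r`, and `0.92 r ≤ t` contradicts `ht`; if `r + 1 ≤ t`, `ht` fails at once
  rcases le_or_gt t r with h | h
  · have := Nat.mul_le_mul_left t hlin
    have := Nat.mul_le_mul_right r hlin
    nlinarith
  · have := Nat.mul_le_mul h h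
    nlinarith

/-- If almost all vertices have distinct degrees, then so do all vertices with at least three
neighbours of degree at least `N / 20`, unless there is a path of length `2 * ℓ + 1` between two
vertices of equal degree; the degree sum is then less than `(N ^ 2 - 1) / 2`. -/
theorem not_equalDegreePathFree_of_injOn_degree {P : Finset V} {ℓ : ℕ} (hℓ : 3 ≤ ℓ)
    (hP : Set.InjOn (fun z => G.degree z) P)
    (hPcard : 1999 * Fintype.card V ≤ 2000 * P.card)
    (hcard : 1000 * (2 * ℓ + 20) ≤ Fintype.card V)
    (hedge : Fintype.card V * Fintype.card V ≤ 2 * ∑ z, G.degree z + 1) :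
    ¬ EqualDegreePathFree G (2 * ℓ + 1) := by
  intro hfree
  set N := Fintype.card V with hN
  have hPle := Finset.card_le_univ P
  have hH1 := card_le_card_filter_le_degree hP (39 * N / 40 + 1)
  have hH2 := card_le_card_filter_le_degree hP (191 * N / 200 + 1)
  have hM := card_le_card_filter_le_degree hP (N / 20 + 1)
  have hM2 := card_le_card_filter_le_degree hP (N / 10)
  have h1 : N ≤ 45 * (Finset.univ.filter fun z => 39 * N ≤ 40 * G.degree z).card := by
    have := Finset.card_le_card (Finset.monotone_filter_right Finset.univ
      (p := fun z => 39 * N / 40 + 1 ≤ G.degree z) (q := fun z => 39 * N ≤ 40 * G.degree z)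
      (by intro z _ hz; omega))
    omega
  have h2 : 43 * N ≤ 1000 * (Finset.univ.filter fun z => 191 * N ≤ 200 * G.degree z).card := by
    have := Finset.card_le_card (Finset.monotone_filter_right Finset.univ
      (p := fun z => 191 * N / 200 + 1 ≤ G.degree z) (q := fun z => 191 * N ≤ 200 * G.degree z)
      (by intro z _ hz; omega))
    omega
  set M := Finset.univ.filter fun z => N ≤ 20 * G.degree z with hMdef
  have hMc : 100 * Mᶜ.card ≤ 6 * N := by
    have := Finset.card_le_card (Finset.monotone_filter_right Finset.univ
      (p := fun z => N / 20 + 1 ≤ G.degree z) (q := fun z => N ≤ 20 * G.degree z)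
      (by intro z _ hz; omega))
    rw [← hMdef] at this
    rw [Finset.card_compl]
    omega
  set S := Finset.univ.filter fun z => 3 ≤ (G.neighborFinset z ∩ M).card with hS
  have hSinj : Set.InjOn (fun z => G.degree z) S := by
    intro z hz z' hz' hzz'
    by_contra hne
    simp only [hS, Finset.coe_filter, Finset.mem_univ, true_and, Set.mem_ofPred_eq] at hz hz'
    have := pathAvoiding_of_many_neighbors h1 h2 hne hz hz' (ℓ - 3) (by omega)
    rw [show 2 * (ℓ - 3) + 7 = 2 * ℓ + 1 by omega] at this
    exact hfree.degree_ne hne this hzz'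
  -- vertices of degree at least `N / 10` have many neighbours in `M`, so `S` is large
  have hsub : Finset.univ.filter (fun z => N / 10 ≤ G.degree z) ⊆ S := by
    intro z hz
    have := card_inter_add_card_inter_compl (G := G) z M
    have h3 := Finset.card_le_card (Finset.inter_subset_right (s₁ := G.neighborFinset z) (s₂ := Mᶜ))
    simp only [Finset.mem_filter, Finset.mem_univ, true_and, hS] at hz ⊢
    omega
  have hSlarge := Finset.card_le_card hsub
  set T := S.filter fun z => S.card ≤ G.degree z with hT
  have hTM : T ⊆ M := by
    intro z hz
    simp only [hT, hMdef, Finset.mem_filter, Finset.mem_univ, true_and] at hz ⊢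
    omega
  have hrs : Sᶜ.card + S.card = N := by rw [Finset.card_compl]; have := Finset.card_le_univ S; omega
  have hRM : ∑ z ∈ Sᶜ, (G.neighborFinset z ∩ M).card ≤ 2 * Sᶜ.card := by
    rw [mul_comm, ← smul_eq_mul]
    refine Finset.sum_le_card_nsmul _ _ _ fun z hz => ?_
    simp only [hS, Finset.mem_compl, Finset.mem_filter, Finset.mem_univ, true_and] at hz
    omega
  have hTR : ∑ z ∈ T, (G.neighborFinset z ∩ Sᶜ).card ≤ 2 * Sᶜ.card := by
    rw [sum_card_neighborFinset_inter_comm]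
    exact (Finset.sum_le_sum fun z _ => Finset.card_le_card
      (Finset.inter_subset_inter_left hTM)).trans hRM
  have hRdeg : ∑ z ∈ Sᶜ, G.degree z ≤ 2 * Sᶜ.card + Sᶜ.card * Mᶜ.card := by
    rw [Finset.sum_congr rfl fun z _ => (card_inter_add_card_inter_compl (G := G) z M).symm,
      Finset.sum_add_distrib]
    refine add_le_add hRM ?_
    rw [← smul_eq_mul]
    exact Finset.sum_le_card_nsmul _ _ _ fun z _ => Finset.card_le_card Finset.inter_subset_right
  -- a vertex of `T` has at least `degree - (s - 1)` neighbours outside `S`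
  have hTdeg : ∀ z ∈ T, G.degree z + 1 - S.card ≤ (G.neighborFinset z ∩ Sᶜ).card := by
    intro z hz
    have := card_inter_add_card_inter_compl (G := G) z S
    have h3 : (G.neighborFinset z ∩ S).card ≤ (S.erase z).card := Finset.card_le_card (by
      intro y hy
      rw [Finset.mem_inter, G.mem_neighborFinset] at hy
      exact Finset.mem_erase.2 ⟨hy.1.ne', hy.2⟩)
    rw [Finset.card_erase_of_mem (Finset.mem_filter.1 hz).1] at h3
    omega
  have hTsum : ∑ z ∈ T, (G.degree z + 1 - S.card) ≤ 2 * Sᶜ.card := (Finset.sum_le_sum hTdeg).trans hTR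
  have hTsum' : ∑ z ∈ T, (G.degree z + 1 - S.card) + T.card * (S.card - 1) = ∑ z ∈ T, G.degree z := by
    rw [← smul_eq_mul, ← Finset.sum_const, ← Finset.sum_add_distrib]
    refine Finset.sum_congr rfl fun z hz => ?_
    have := (Finset.mem_filter.1 hz).2
    omega
  -- the numbers `degree - (s - 1)` are distinct and positive on `T`
  have hTt : T.card * T.card + T.card ≤ 4 * Sᶜ.card := by
    have := card_mul_card_le_sum_of_injOn (S := T) (f := fun z => G.degree z - S.card) (by
      intro a ha b hb hab
      have ha2 := Finset.mem_filter.1 ha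
      have hb2 := Finset.mem_filter.1 hb
      refine hSinj ha2.1 hb2.1 ?_
      simp only at hab ⊢
      omega)
    have h4 : ∑ z ∈ T, (G.degree z + 1 - S.card) = ∑ z ∈ T, (G.degree z - S.card) + T.card := by
      rw [show T.card = ∑ z ∈ T, 1 by simp, ← Finset.sum_add_distrib]
      refine Finset.sum_congr rfl fun z hz => ?_
      have := (Finset.mem_filter.1 hz).2
      omega
    omega
  have hlow : 2 * ∑ z ∈ S.filter (fun z => ¬ S.card ≤ G.degree z), G.degree z ≤
      S.card * (S.card - 1) := by
    set L := S.filter (fun z => ¬ S.card ≤ G.degree z) with hL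
    have := sum_le_of_injOn (S := L) (f := fun z => G.degree z) (M := S.card - 1)
      (hSinj.mono (by intro z hz; exact (Finset.mem_filter.1 hz).1)) (by
        intro z hz
        have := (Finset.mem_filter.1 hz).2
        omega)
    have h5 : L.card ≤ S.card := Finset.card_le_card (Finset.filter_subset _ _)
    obtain ⟨s, hs⟩ : ∃ s, S.card = s + 1 := ⟨S.card - 1, by omega⟩
    rw [hs] at this h5 ⊢
    simp only [Nat.add_sub_cancel] at this ⊢
    exact mul_pred_bound this h5
  have htot : ∑ z, G.degree z = ∑ z ∈ Sᶜ, G.degree z + (∑ z ∈ T, G.degree z +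
      ∑ z ∈ S.filter (fun z => ¬ S.card ≤ G.degree z), G.degree z) := by
    rw [Finset.sum_filter_add_sum_filter_not, Finset.sum_compl_add_sum]
  obtain ⟨s, hs⟩ : ∃ s, S.card = s + 1 := ⟨S.card - 1, by omega⟩
  rw [hs, Nat.add_sub_cancel] at hTsum' hlow
  rw [htot, ← hTsum'] at hedge
  rw [hs] at hrs hSlarge hedge hTsum
  refine false_of_degree_sum_bounds hrs hedge hTsum hTt hlow hRdeg ?_ ?_ <;> omega

end HalfGraph

/-! ### Graphs close to a balanced complete bipartite graph -/

section NearBipartite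

variable {V : Type*} [Fintype V] [DecidableEq V] {G : SimpleGraph V} [DecidableRel G.Adj]

/-- The pair `Q`, `B` is nearly complete, with typical parts `A ⊆ Q` and `C ⊆ B`: all but `N / 100`
vertices of `Q` lie in `A`, each vertex of `A` is adjacent to all but `N / 100` vertices of `B`, and
symmetrically. Here `N` is the number of vertices of `G`. -/
structure IsRobustPair (G : SimpleGraph V) [DecidableRel G.Adj] (Q B A C : Finset V) : Prop where
  subset_left : A ⊆ Q
  subset_right : C ⊆ B
  large_left : 4 * Fintype.card V ≤ 10 * A.card
  large_right : 4 * Fintype.card V ≤ 10 * C.card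
  small_left : 100 * (Q \ A).card ≤ Fintype.card V
  small_right : 100 * (B \ C).card ≤ Fintype.card V
  dense_left : ∀ a ∈ A, 100 * (B \ G.neighborFinset a).card ≤ Fintype.card V
  dense_right : ∀ c ∈ C, 100 * (Q \ G.neighborFinset c).card ≤ Fintype.card V

omit [Fintype V] in
theorem card_le_card_inter_add_card_sdiff {S T U : Finset V} (h : S ⊆ T) :
    S.card ≤ (S ∩ U).card + (T \ U).card := by
  have h1 := Finset.card_inter_add_card_sdiff S U
  have h2 := Finset.card_le_card (Finset.sdiff_subset_sdiff h (le_refl U))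
  omega

/-- A vertex with many neighbours in `B` is joined to every vertex of `A` by paths of all
moderate even lengths. -/
theorem IsRobustPair.pathAvoiding_even {Q B A C : Finset V} (h : IsRobustPair G Q B A C) (j : ℕ)
    {F : Finset V} {x w : V} (hx : Fintype.card V ≤ 10 * (G.neighborFinset x ∩ B).card)
    (hw : w ∈ A) (hxF : x ∉ F) (hwF : w ∉ F) (hxw : x ≠ w)
    (hcard : 100 * (F.card + 2 * j + 10) ≤ Fintype.card V) :
    PathAvoiding G F (2 * j + 2) x w := by
  induction j generalizing F x with
  | zero =>
    have h1 := card_le_card_inter_add_card_sdiff (U := G.neighborFinset w)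
      (Finset.inter_subset_right (s₁ := G.neighborFinset x) (s₂ := B))
    have h2 := h.dense_left w hw
    obtain ⟨b, hb, bx, bw, bF⟩ := exists_mem_notMem_insert₂
      (S := G.neighborFinset x ∩ B ∩ G.neighborFinset w) (F := F) (a := x) (b := w) (by omega)
    simp only [Finset.mem_inter, G.mem_neighborFinset] at hb
    exact .two hb.1.1 hb.2.symm hxF bF hwF hxw.symm
  | succ j ih =>
    have h1 := card_le_card_inter_add_card_sdiff (U := C)
      (Finset.inter_subset_right (s₁ := G.neighborFinset x) (s₂ := B))
    have h2 := h.small_right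
    obtain ⟨b, hb, bx, bw, bF⟩ := exists_mem_notMem_insert₂
      (S := G.neighborFinset x ∩ B ∩ C) (F := F) (a := x) (b := w) (by omega)
    simp only [Finset.mem_inter, G.mem_neighborFinset] at hb
    have h3 := card_le_card_inter_add_card_sdiff (U := G.neighborFinset b) h.subset_left
    have h4 := h.dense_right b hb.2
    have h5 := h.large_left
    obtain ⟨a, ha, ax, aw, ab, aF⟩ := exists_mem_notMem_insert₃
      (S := A ∩ G.neighborFinset b) (F := F) (a := x) (b := w) (c := b) (by omega)
    simp only [Finset.mem_inter, G.mem_neighborFinset] at ha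
    have h6 := card_le_card_inter_add_card_sdiff (U := G.neighborFinset a) h.subset_right
    have h7 := h.dense_left a ha.1
    have h8 := h.large_right
    have h9 := Finset.card_le_card (show C ∩ G.neighborFinset a ⊆ G.neighborFinset a ∩ B by
      intro z hz
      rw [Finset.mem_inter] at hz ⊢
      exact ⟨hz.2, h.subset_right hz.1⟩)
    have hc1 := Finset.card_insert_le x F
    have hc2 := Finset.card_insert_le b (insert x F)
    exact .cons hb.1.1 hxF (.cons ha.2 (by simp [bx, bF]) (ih (by omega)
      (by simp [ab, ax, aF]) (by simp [bw.symm, hxw.symm, hwF]) aw (by omega)))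

/-- A vertex with many neighbours in `Q` is joined to every vertex of `A` by paths of all
moderate odd lengths from `3` on. -/
theorem IsRobustPair.pathAvoiding_odd {Q B A C : Finset V} (h : IsRobustPair G Q B A C) (j : ℕ)
    {F : Finset V} {x w : V} (hx : Fintype.card V ≤ 10 * (G.neighborFinset x ∩ Q).card)
    (hw : w ∈ A) (hxF : x ∉ F) (hwF : w ∉ F) (hxw : x ≠ w)
    (hcard : 100 * (F.card + 2 * j + 12) ≤ Fintype.card V) :
    PathAvoiding G F (2 * j + 3) x w := by
  have h1 := card_le_card_inter_add_card_sdiff (U := A)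
    (Finset.inter_subset_right (s₁ := G.neighborFinset x) (s₂ := Q))
  have h2 := h.small_left
  obtain ⟨a, ha, ax, aw, aF⟩ := exists_mem_notMem_insert₂
    (S := G.neighborFinset x ∩ Q ∩ A) (F := F) (a := x) (b := w) (by omega)
  simp only [Finset.mem_inter, G.mem_neighborFinset] at ha
  have h6 := card_le_card_inter_add_card_sdiff (U := G.neighborFinset a) h.subset_right
  have h7 := h.dense_left a ha.2
  have h8 := h.large_right
  have h9 := Finset.card_le_card (show C ∩ G.neighborFinset a ⊆ G.neighborFinset a ∩ B by
    intro z hz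
    rw [Finset.mem_inter] at hz ⊢
    exact ⟨hz.2, h.subset_right hz.1⟩)
  have hc1 := Finset.card_insert_le x F
  exact .cons ha.1.1 hxF (h.pathAvoiding_even j (by omega) hw (by simp [ax, aF])
    (by simp [hxw.symm, hwF]) aw (by omega))

/-- Two vertices of `A` outside a given small set are joined by an odd path through an edge
between two vertices both of which have many neighbours in `B`. -/
theorem IsRobustPair.pathAvoiding_of_adj_left {Q B A C : Finset V} (h : IsRobustPair G Q B A C)
    (j : ℕ) {x x' u w : V} (hadj : G.Adj x x')
    (hx : Fintype.card V ≤ 10 * (G.neighborFinset x ∩ B).card)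
    (hx' : Fintype.card V ≤ 10 * (G.neighborFinset x' ∩ B).card)
    (hu : u ∈ A) (hw : w ∈ A) (huw : u ≠ w) (hux : u ≠ x) (hux' : u ≠ x') (hwx : w ≠ x)
    (hwx' : w ≠ x') (hcard : 100 * (2 * j + 20) ≤ Fintype.card V) :
    PathAvoiding G ∅ (2 * j + 5) u w := by
  have h1 := card_le_card_inter_add_card_sdiff (U := G.neighborFinset u)
      (Finset.inter_subset_right (s₁ := G.neighborFinset x) (s₂ := B))
  have h2 := h.dense_left u hu
  obtain ⟨b, hb, bx', bw, bu⟩ := exists_mem_notMem_insert₂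
      (S := G.neighborFinset x ∩ B ∩ G.neighborFinset u) (F := {u}) (a := x') (b := w)
      (by rw [Finset.card_singleton]; omega)
  simp only [Finset.mem_inter, G.mem_neighborFinset] at hb
  refine .cons hb.2 (by simp) (.cons hb.1.1.symm (by simpa using bu) (.cons hadj
    (by simp [hux.symm, hb.1.1.ne]) (h.pathAvoiding_even j hx' hw
    (by simp [hux'.symm, bx'.symm, hadj.ne']) (by simp [hwx, huw.symm, bw.symm]) hwx'.symm ?_)))
  have := Finset.card_le_three (a := x) (b := b) (c := u)
  simp only [insert_empty_eq]
  omega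

/-- As `IsRobustPair.pathAvoiding_of_adj_left`, with an edge between two vertices that have many
neighbours in `Q`. Reaching such an edge takes three steps on either side, so that the shortest
path has length `7`. -/
theorem IsRobustPair.pathAvoiding_of_adj_right {Q B A C : Finset V} (h : IsRobustPair G Q B A C)
    (j : ℕ) {x x' u w : V} (hadj : G.Adj x x')
    (hx : Fintype.card V ≤ 10 * (G.neighborFinset x ∩ Q).card)
    (hx' : Fintype.card V ≤ 10 * (G.neighborFinset x' ∩ Q).card)
    (hu : u ∈ A) (hw : w ∈ A) (huw : u ≠ w) (hux : u ≠ x) (hux' : u ≠ x') (hwx : w ≠ x)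
    (hwx' : w ≠ x') (hcard : 100 * (2 * j + 20) ≤ Fintype.card V) :
    PathAvoiding G ∅ (2 * j + 7) u w := by
  have h1 := h.large_right
  have h2 := h.dense_left u hu
  have h3 := card_le_card_inter_add_card_sdiff (U := G.neighborFinset u) h.subset_right
  obtain ⟨c, hc, cx, cx', cw, cu⟩ := exists_mem_notMem_insert₃
      (S := C ∩ G.neighborFinset u) (F := {u}) (a := x) (b := x') (c := w)
      (by rw [Finset.card_singleton]; omega)
  have h4 := h.dense_right c (Finset.mem_inter.1 hc).1
  have h5 := card_le_card_inter_add_card_sdiff (U := G.neighborFinset c)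
    (Finset.inter_subset_right (s₁ := G.neighborFinset x) (s₂ := Q))
  obtain ⟨a, ha, ax', aw, ac, au⟩ := exists_mem_notMem_insert₃
      (S := G.neighborFinset x ∩ Q ∩ G.neighborFinset c) (F := {u}) (a := x') (b := w) (c := c)
      (by rw [Finset.card_singleton]; omega)
  simp only [Finset.mem_inter, G.mem_neighborFinset] at hc ha
  refine .cons hc.2 (by simp) (.cons ha.2 (by simpa using cu) (.cons ha.1.1.symm
    (by simpa [ac] using au) (.cons hadj (by simp [hux.symm, cx.symm, ha.1.1.ne])
    (h.pathAvoiding_odd j hx' hw (by simp [hux'.symm, cx'.symm, ax'.symm, hadj.ne'])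
      (by simp [hwx, huw.symm, cw.symm, aw.symm]) hwx'.symm ?_))))
  have := Finset.card_le_four (a := x) (b := a) (c := c) (d := u)
  simp only [insert_empty_eq]
  omega

/-- A vertex with many neighbours in both parts also allows a change of parity. -/
theorem IsRobustPair.pathAvoiding_of_both {Q B A C : Finset V} (h : IsRobustPair G Q B A C)
    (j : ℕ) {z u w : V}
    (hz : Fintype.card V ≤ 10 * (G.neighborFinset z ∩ B).card)
    (hz' : Fintype.card V ≤ 10 * (G.neighborFinset z ∩ Q).card)
    (hu : u ∈ A) (hw : w ∈ A) (huw : u ≠ w) (huz : u ≠ z) (hwz : w ≠ z)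
    (hcard : 100 * (2 * j + 20) ≤ Fintype.card V) :
    PathAvoiding G ∅ (2 * j + 5) u w := by
  have h1 := card_le_card_inter_add_card_sdiff (U := G.neighborFinset u)
      (Finset.inter_subset_right (s₁ := G.neighborFinset z) (s₂ := B))
  have h2 := h.dense_left u hu
  obtain ⟨b, hb, bw, bu⟩ := exists_mem_notMem_insert
      (S := G.neighborFinset z ∩ B ∩ G.neighborFinset u) (F := {u}) (a := w)
      (by rw [Finset.card_singleton]; omega)
  simp only [Finset.mem_inter, G.mem_neighborFinset] at hb
  refine .cons hb.2 (by simp) (.cons hb.1.1.symm (by simpa using bu)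
    (h.pathAvoiding_odd j hz' hw (by simp [huz.symm, hb.1.1.ne]) (by simp [huw.symm, bw.symm])
      hwz.symm ?_))
  have := Finset.card_le_two (a := b) (b := u)
  simp only [insert_empty_eq]
  omega

/-- As `|Q| * |B| ≤ N ^ 2 / 4`, at most `N ^ 2 / 10 ^ 4` pairs in `Q × B` are non-adjacent, so at most
`N / 100` vertices have more than `N / 100` non-neighbours in the other part. -/
theorem exists_isRobustPair {Q B : Finset V} (hQB : Disjoint Q B)
    (hdense : 2499 * (Fintype.card V * Fintype.card V) ≤
      10000 * ∑ z ∈ Q, (G.neighborFinset z ∩ B).card) :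
    ∃ A C, IsRobustPair G Q B A C ∧ 48 * Fintype.card V ≤ 100 * A.card ∧
      48 * Fintype.card V ≤ 100 * C.card ∧ 98 * Fintype.card V ≤ 100 * (Q.card + B.card) := by
  set N := Fintype.card V with hN
  have hsum : Q.card + B.card ≤ N := by
    rw [← Finset.card_union_of_disjoint hQB]
    exact Finset.card_le_univ _
  have key : ∀ S T : Finset V, S.card + T.card ≤ N → 2499 * (N * N) ≤
      10000 * ∑ z ∈ S, (G.neighborFinset z ∩ T).card → 49 * N ≤ 100 * S.card ∧
      100 * (S \ S.filter fun z => 100 * (T \ G.neighborFinset z).card ≤ N).card ≤ N := by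
    intro S T hST hd
    have h1 : ∑ z ∈ S, (G.neighborFinset z ∩ T).card + ∑ z ∈ S, (T \ G.neighborFinset z).card =
        S.card * T.card := by
      rw [← Finset.sum_add_distrib, ← smul_eq_mul, ← Finset.sum_const]
      refine Finset.sum_congr rfl fun z _ => ?_
      rw [Finset.inter_comm]
      exact Finset.card_inter_add_card_sdiff _ _
    set D := S \ S.filter fun z => 100 * (T \ G.neighborFinset z).card ≤ N with hD
    have h2 : D.card * (N + 1) ≤ 100 * ∑ z ∈ S, (T \ G.neighborFinset z).card := by
      rw [Finset.mul_sum, ← smul_eq_mul]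
      refine (Finset.card_nsmul_le_sum D _ _ fun z hz => ?_).trans
        (Finset.sum_le_sum_of_subset (f := fun z => 100 * (T \ G.neighborFinset z).card)
          Finset.sdiff_subset)
      simp only [hD, Finset.mem_sdiff, Finset.mem_filter, not_and] at hz
      have := hz.2 hz.1
      omega
    generalize S.card = s at *
    generalize T.card = t at *
    generalize D.card = d at *
    have h3 : 4 * (s * t) ≤ N * N := by
      zify at hST ⊢
      nlinarith [sq_nonneg ((s : ℤ) - t), mul_self_nonneg ((s : ℤ) + t)]
    constructor
    · by_contra hlt
      push Not at hlt
      have h4 : s * t ≤ s * (N - s) := Nat.mul_le_mul_left _ (by omega)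
      obtain ⟨y, hy⟩ : ∃ y, N = s + y := ⟨N - s, by omega⟩
      rw [hy, Nat.add_sub_cancel_left] at h4
      rw [hy] at hlt hd
      nlinarith
    · have h5 : 100 * d * (N + 1) ≤ N * (N + 1) := by nlinarith
      exact Nat.le_of_mul_le_mul_right h5 (by omega)
  obtain ⟨hQ, hQA⟩ := key Q B hsum hdense
  obtain ⟨hB, hBC⟩ := key B Q (by omega) (by rwa [sum_card_neighborFinset_inter_comm])
  have e1 := Finset.card_sdiff_add_card_eq_card
    (Finset.filter_subset (fun z => 100 * (B \ G.neighborFinset z).card ≤ N) Q)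
  have e2 := Finset.card_sdiff_add_card_eq_card
    (Finset.filter_subset (fun z => 100 * (Q \ G.neighborFinset z).card ≤ N) B)
  refine ⟨_, _, ⟨Finset.filter_subset _ _, Finset.filter_subset _ _, ?_, ?_, hQA, hBC,
    fun a ha => (Finset.mem_filter.1 ha).2, fun a ha => (Finset.mem_filter.1 ha).2⟩, ?_, ?_, ?_⟩
  all_goals omega

/-- The degrees of the vertices in `A` lie between `|B| - N / 100` and `|B| + 1`, so two of them
coincide, even after two vertices are excluded. -/
theorem exists_degree_eq_of_isRobustPair {Q B A C : Finset V} (h : IsRobustPair G Q B A C)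
    (hdeg : ∀ q ∈ Q, G.degree q ≤ B.card + 1) (hcard : 100 ≤ Fintype.card V) (x x' : V) :
    ∃ u ∈ A, ∃ w ∈ A, u ≠ w ∧ G.degree u = G.degree w ∧ u ≠ x ∧ u ≠ x' ∧ w ≠ x ∧ w ≠ x' := by
  have h1 : (A \ {x, x'}).card + 2 ≥ A.card := by
    have := Finset.le_card_sdiff {x, x'} A
    have := Finset.card_le_two (a := x) (b := x')
    omega
  have h2 := h.large_left
  obtain ⟨u, hu, w, hw, huw, hd⟩ := Finset.exists_ne_map_eq_of_card_lt_of_maps_to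
    (s := A \ {x, x'}) (t := Finset.Icc (B.card - Fintype.card V / 100) (B.card + 1))
    (f := fun z => G.degree z) (by rw [Nat.card_Icc]; omega) (by
      intro z hz
      have hzA := (Finset.mem_sdiff.1 hz).1
      have h3 := h.dense_left z hzA
      have h4 := card_le_card_inter_add_card_sdiff (U := G.neighborFinset z) (le_refl B)
      have h5 := Finset.card_le_card (Finset.inter_subset_right (s₁ := B) (s₂ := G.neighborFinset z))
      rw [G.card_neighborFinset_eq_degree] at h5
      have h6 := hdeg z (h.subset_left hzA)
      simp only [Finset.coe_Icc, Set.mem_Icc]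
      omega)
  simp only [Finset.mem_sdiff, Finset.mem_insert, Finset.mem_singleton, not_or] at hu hw
  exact ⟨u, hu.1, w, hw.1, huw, hd, hu.2.1, hu.2.2, hw.2.1, hw.2.2⟩

/-- The parts are the sets `L` and `R` of vertices with at least `N / 10` neighbours in `B` and `Q`,
respectively. Odd paths show that they are disjoint and independent. A vertex in neither has degree
at most `0.22 N`, which is too small compared with the average contribution `N / 2`. -/
theorem exists_bipartition_of_nearly_complete {Q B : Finset V} {ℓ : ℕ} (hℓ : 3 ≤ ℓ)
    (hQB : Disjoint Q B)
    (hdense : 2499 * (Fintype.card V * Fintype.card V) ≤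
      10000 * ∑ z ∈ Q, (G.neighborFinset z ∩ B).card)
    (hdeg : ∀ q ∈ Q, G.degree q ≤ B.card + 1)
    (hcard : 100 * (2 * ℓ + 20) ≤ Fintype.card V)
    (hedge : Fintype.card V * Fintype.card V ≤ 2 * ∑ z, G.degree z + 1)
    (hfree : EqualDegreePathFree G (2 * ℓ + 1)) :
    ∃ L : Finset V, ∀ x y, G.Adj x y → (x ∈ L ↔ y ∉ L) := by
  obtain ⟨A, C, h, hA, hC, hQBcard⟩ := exists_isRobustPair hQB hdense
  have hpair := exists_degree_eq_of_isRobustPair h hdeg (by omega)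
  set N := Fintype.card V with hN
  set L := Finset.univ.filter fun z => N ≤ 10 * (G.neighborFinset z ∩ B).card with hL
  set R := Finset.univ.filter fun z => N ≤ 10 * (G.neighborFinset z ∩ Q).card with hR
  have hLR : Disjoint L R := by
    rw [Finset.disjoint_left]
    intro z hz hz'
    simp only [hL, hR, Finset.mem_filter, Finset.mem_univ, true_and] at hz hz'
    obtain ⟨u, hu, w, hw, huw, hd, hux, -, hwx, -⟩ := hpair z z
    have := h.pathAvoiding_of_both (ℓ - 2) hz hz' hu hw huw hux hwx (by omega)
    rw [show 2 * (ℓ - 2) + 5 = 2 * ℓ + 1 by omega] at this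
    exact hfree.degree_ne huw this hd
  have hLL : ∀ x ∈ L, ∀ y ∈ L, ¬ G.Adj x y := by
    intro x hx y hy hxy
    simp only [hL, Finset.mem_filter, Finset.mem_univ, true_and] at hx hy
    obtain ⟨u, hu, w, hw, huw, hd, hux, huy, hwx, hwy⟩ := hpair x y
    have := h.pathAvoiding_of_adj_left (ℓ - 2) hxy hx hy hu hw huw hux huy hwx hwy (by omega)
    rw [show 2 * (ℓ - 2) + 5 = 2 * ℓ + 1 by omega] at this
    exact hfree.degree_ne huw this hd
  have hRR : ∀ x ∈ R, ∀ y ∈ R, ¬ G.Adj x y := by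
    intro x hx y hy hxy
    simp only [hR, Finset.mem_filter, Finset.mem_univ, true_and] at hx hy
    obtain ⟨u, hu, w, hw, huw, hd, hux, huy, hwx, hwy⟩ := hpair x y
    have := h.pathAvoiding_of_adj_right (ℓ - 3) hxy hx hy hu hw huw hux huy hwx hwy (by omega)
    rw [show 2 * (ℓ - 3) + 7 = 2 * ℓ + 1 by omega] at this
    exact hfree.degree_ne huw this hd
  have hAL : A ⊆ L := by
    intro z hz
    have h3 := h.dense_left z hz
    have h4 := card_le_card_inter_add_card_sdiff (U := G.neighborFinset z) h.subset_right
    have h5 : C ∩ G.neighborFinset z ⊆ G.neighborFinset z ∩ B := by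
      intro y hy
      rw [Finset.mem_inter] at hy ⊢
      exact ⟨hy.2, h.subset_right hy.1⟩
    have := Finset.card_le_card h5
    simp only [hL, Finset.mem_filter, Finset.mem_univ, true_and]
    omega
  have hCR : C ⊆ R := by
    intro z hz
    have h3 := h.dense_right z hz
    have h4 := card_le_card_inter_add_card_sdiff (U := G.neighborFinset z) h.subset_left
    have h5 : A ∩ G.neighborFinset z ⊆ G.neighborFinset z ∩ Q := by
      intro y hy
      rw [Finset.mem_inter] at hy ⊢
      exact ⟨hy.2, h.subset_left hy.1⟩
    have := Finset.card_le_card h5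
    simp only [hR, Finset.mem_filter, Finset.mem_univ, true_and]
    omega
  set W := (L ∪ R)ᶜ with hW
  have hWcard : W.card + (L.card + R.card) = N := by
    rw [← Finset.card_union_of_disjoint hLR, add_comm]
    exact Finset.card_add_card_compl _
  have hAc := Finset.card_le_card hAL
  have hCc := Finset.card_le_card hCR
  have hWdeg : ∀ z ∈ W, 100 * G.degree z ≤ 22 * N := by
    intro z hz
    simp only [hW, Finset.mem_compl, Finset.mem_union, not_or, hL, hR, Finset.mem_filter,
      Finset.mem_univ, true_and] at hz
    have h1 := card_inter_add_card_inter_compl (G := G) z (Q ∪ B)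
    have h2 := Finset.card_le_card (Finset.inter_subset_right
      (s₁ := G.neighborFinset z) (s₂ := (Q ∪ B)ᶜ))
    rw [Finset.card_compl, Finset.card_union_of_disjoint hQB] at h2
    have h3 := Finset.card_union_le (G.neighborFinset z ∩ Q) (G.neighborFinset z ∩ B)
    rw [← Finset.inter_union_distrib_left] at h3
    omega
  have hside : ∀ S T : Finset V, (∀ x ∈ S, ∀ y ∈ S, ¬ G.Adj x y) → (S ∪ T)ᶜ = W →
      ∑ z ∈ S, G.degree z ≤ S.card * T.card + ∑ z ∈ S, (G.neighborFinset z ∩ W).card := by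
    intro S T hS hSW
    rw [← smul_eq_mul, ← Finset.sum_const, ← Finset.sum_add_distrib]
    refine Finset.sum_le_sum fun z hz => ?_
    have hsub : G.neighborFinset z ⊆ T ∪ (G.neighborFinset z ∩ W) := by
      intro y hy
      have hy' := (G.mem_neighborFinset _ _).1 hy
      have : y ∉ S := fun hyS => hS z hz y hyS hy'
      by_cases hyT : y ∈ T
      · exact Finset.mem_union_left _ hyT
      · refine Finset.mem_union_right _ (Finset.mem_inter.2 ⟨hy, ?_⟩)
        rw [← hSW, Finset.mem_compl, Finset.mem_union, not_or]
        exact ⟨this, hyT⟩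
    rw [← G.card_neighborFinset_eq_degree]
    exact (Finset.card_le_card hsub).trans (Finset.card_union_le _ _)
  have hWsum : ∑ z ∈ L, (G.neighborFinset z ∩ W).card + ∑ z ∈ R, (G.neighborFinset z ∩ W).card ≤
      ∑ z ∈ W, G.degree z := by
    rw [sum_card_neighborFinset_inter_comm L, sum_card_neighborFinset_inter_comm R,
      ← Finset.sum_add_distrib]
    refine Finset.sum_le_sum fun z _ => ?_
    rw [← Finset.card_union_of_disjoint (Finset.disjoint_of_subset_left Finset.inter_subset_right
      (Finset.disjoint_of_subset_right Finset.inter_subset_right hLR)),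
      ← G.card_neighborFinset_eq_degree]
    exact Finset.card_le_card (Finset.union_subset Finset.inter_subset_left Finset.inter_subset_left)
  have hLs := hside L R hLL rfl
  have hRs := hside R L hRR (by rw [Finset.union_comm])
  have hWs : 100 * ∑ z ∈ W, G.degree z ≤ W.card * (22 * N) := by
    rw [Finset.mul_sum, ← smul_eq_mul]
    exact Finset.sum_le_card_nsmul _ _ _ hWdeg
  have htot : ∑ z, G.degree z = ∑ z ∈ W, G.degree z + (∑ z ∈ L, G.degree z + ∑ z ∈ R, G.degree z) := by
    rw [← Finset.sum_union hLR, Finset.sum_compl_add_sum]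
  have hWempty : W.card = 0 := by
    by_contra hne
    rw [htot] at hedge
    clear_value N
    have hω : 100 * W.card ≤ 4 * N := by omega
    generalize W.card = ω at *
    generalize L.card = l at *
    generalize R.card = r at *
    have hlr : 4 * (l * r) ≤ (l + r) * (l + r) := by
      zify
      nlinarith [sq_nonneg ((l : ℤ) - r)]
    have e : N * N = (l + r) * (l + r) + 2 * (ω * N) - ω * ω := by
      rw [← hWcard]
      zify [show ω * ω ≤ (l + r) * (l + r) + 2 * (ω * (ω + (l + r))) by nlinarith]
      ring
    have h1 : 100 * (ω * ω) ≤ 4 * (ω * N) := by nlinarith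
    have h2 : N ≤ ω * N := Nat.le_mul_of_pos_left _ (by omega)
    have h3 : ω * (22 * N) = 22 * (ω * N) := by ring
    rw [mul_comm r l] at hRs
    omega
  refine ⟨L, fun x y hxy => ⟨fun hx hy => hLL x hx y hy hxy, fun hy => ?_⟩⟩
  by_contra hx
  have : ∀ z, z ∉ L → z ∈ R := by
    intro z hz
    by_contra hzR
    have : z ∈ W := by simp [hW, hz, hzR]
    rw [Finset.card_eq_zero.1 hWempty] at this
    simp at this
  exact hRR x (this x hx) y (this y hy) hxy

end NearBipartite

/-! ### The optimization behind the dichotomy -/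

/-- All quantities are relative to the number of vertices: `p` and `q` are the sizes of the set of
representatives and of its complement in the core, `m ≤ D` bounds the degrees of the representatives,
`δ` bounds the core degrees of the other vertices, which sum to `s`, and `D` is the maximum degree.
With `m = D` alone, equality in the count is possible for every `p`, with `D = (1 + p) / 2` and
`q = δ = (1 - p) / 2`; the further bound on `m` then forces `p` close to `0` or `1`. -/
theorem stability_inequality {p q δ D m s : ℝ} (h1 : 1 ≤ 2 * p * m - p ^ 2 + 2 * s +
    2 * (1 - D) * D + 1 / 10 ^ 10) (h2 : s ≤ q * δ) (h3 : δ ≤ 1 - p - q + 1 / 10 ^ 10)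
    (h4 : m ≤ D) (h5 : m ≤ 1 - p - q + 1 / 10 ^ 10 ∨ m ≤ 1 - q - δ + 1 / 10 ^ 10)
    (hp : 0 ≤ p) (hq : 0 ≤ q) (hpq : p + q ≤ 1) (hD : D ≤ 1) (h7 : p < 1999 / 2000) :
    24991 / 100000 ≤ s := by
  -- the sum of the squares measures the distance to `D = (1 + p) / 2`, `q = δ = (1 - p) / 2`
  have key : 2 * (p * (D - m)) + 2 * (D - (1 + p) / 2) ^ 2 + 2 * (q - (1 - p) / 2) ^ 2 +
      2 * (q * (1 - p - q - δ)) ≤ 1 / 10 ^ 10 := by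
    linarith
  have hpm : 0 ≤ p * (D - m) := mul_nonneg hp (by linarith)
  have hqg : -(1 / 10 ^ 10) ≤ q * (1 - p - q - δ) := by nlinarith
  have hD1 : (1 + p) / 2 - D ≤ 2 / 10 ^ 5 := by
    refine (abs_le_of_sq_le_sq' ?_ (by norm_num)).2
    linarith [sq_nonneg (q - (1 - p) / 2), sq_nonneg (D - (1 + p) / 2)]
  have hq1 : |q - (1 - p) / 2| ≤ 2 / 10 ^ 5 := by
    refine abs_le_of_sq_le_sq ?_ (by norm_num)
    linarith [sq_nonneg (q - (1 - p) / 2), sq_nonneg (D - (1 + p) / 2)]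
  rw [abs_le] at hq1
  have hpm' : p * (D - m) ≤ 3 / 2 / 10 ^ 10 := by
    linarith [sq_nonneg (q - (1 - p) / 2), sq_nonneg (D - (1 + p) / 2)]
  have hg : 1 - p - q - δ ≤ 1 / 10 ^ 6 := by
    by_contra hlt
    push Not at hlt
    have : 2 / 10 ^ 4 * (1 / 10 ^ 6) ≤ q * (1 - p - q - δ) :=
      mul_le_mul (by linarith) hlt.le (by norm_num) hq
    linarith [sq_nonneg (q - (1 - p) / 2), sq_nonneg (D - (1 + p) / 2)]
  have hp6 : p ≤ 6 / 10 ^ 5 := by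
    by_contra hlt
    push Not at hlt
    rcases h5 with h5 | h5
    · have : 6 / 10 ^ 5 * (9 / 10 ^ 6) ≤ p * (D - m) :=
        mul_le_mul hlt.le (by linarith) (by norm_num) hp
      linarith
    · have : 6 / 10 ^ 5 * (1 / 10 ^ 4) ≤ p * (D - m) :=
        mul_le_mul hlt.le (by linarith) (by norm_num) hp
      linarith
  have hpm1 : p * m ≤ 6 / 10 ^ 5 := by nlinarith
  nlinarith [sq_nonneg (D - 1 / 2), sq_nonneg p]

theorem stability_inequality_scaled {N p q δ D M σ : ℝ} (hN : 0 < N)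
    (h1 : N ^ 2 ≤ 2 * p * M - p ^ 2 + 2 * σ + 2 * (N - D) * D + N ^ 2 / 10 ^ 10)
    (h2 : σ ≤ q * δ) (h3 : δ ≤ N - p - q + N / 10 ^ 10) (h4 : M ≤ D)
    (h5 : M ≤ N - p - q + N / 10 ^ 10 ∨ M ≤ N - q - δ + N / 10 ^ 10)
    (hp : 0 ≤ p) (hq : 0 ≤ q) (hpq : p + q ≤ N) (hD : D ≤ N) (h7 : p < 1999 / 2000 * N) :
    24991 / 100000 * N ^ 2 ≤ σ := by
  have hN2 : 0 < N ^ 2 := by positivity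
  have e1 : ∀ x : ℝ, N * (x / N) = x := fun x => by field_simp
  have e2 : N ^ 2 * (σ / N ^ 2) = σ := by field_simp
  have := stability_inequality (p := p / N) (q := q / N) (δ := δ / N) (D := D / N) (m := M / N)
    (s := σ / N ^ 2) ?_ ?_ ?_ ?_ ?_ (by positivity) (by positivity) ?_ ?_ ?_
  · rwa [le_div_iff₀ hN2] at this
  · refine le_of_mul_le_mul_left ?_ hN2
    field_simp
    field_simp at h1
    linarith
  · rw [div_mul_div_comm, ← sq]
    gcongr
  · refine le_of_mul_le_mul_left ?_ hN
    linarith [e1 p, e1 q, e1 δ]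
  · gcongr
  · refine h5.imp (fun h5 => ?_) (fun h5 => ?_) <;>
    · refine le_of_mul_le_mul_left ?_ hN
      linarith [e1 p, e1 q, e1 δ, e1 M]
  · refine le_of_mul_le_mul_left ?_ hN
    linarith [e1 p, e1 q]
  · rwa [div_le_one hN]
  · rwa [div_lt_iff₀ hN]

/-! ### A core of the neighbourhood of a vertex -/

section Core

variable {V : Type*} [Fintype V] [DecidableEq V] {G : SimpleGraph V} [DecidableRel G.Adj]

/-- A bipartite subgraph of large minimum degree that loses few edges. It maximizes the number of
edges between the two parts plus `c` times the number of discarded vertices. -/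
theorem exists_core (A Y : Finset V) (c : ℕ) : ∃ A' ⊆ A, ∃ X ⊆ Y,
    (∀ a ∈ A', c ≤ (G.neighborFinset a ∩ X).card) ∧
    (∀ x ∈ X, c ≤ (G.neighborFinset x ∩ A').card) ∧
    ∑ a ∈ A, (G.neighborFinset a ∩ Y).card ≤
      ∑ a ∈ A', (G.neighborFinset a ∩ X).card + c * (A.card + Y.card) := by
  obtain ⟨⟨A', X⟩, hmem, hmax⟩ := Finset.exists_max_image (A.powerset ×ˢ Y.powerset)
    (fun T => ∑ a ∈ T.1, (G.neighborFinset a ∩ T.2).card + c * ((A \ T.1).card + (Y \ T.2).card))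
    ⟨(A, Y), by simp⟩
  simp only [Finset.mem_product, Finset.mem_powerset, Prod.forall] at hmem hmax
  have hsd : ∀ (S T : Finset V) (a : V), T ⊆ S → a ∈ T →
      (S \ T.erase a).card = (S \ T).card + 1 := by
    intro S T a hT ha
    have h1 := Finset.card_sdiff_add_card_eq_card hT
    have h2 := Finset.card_sdiff_add_card_eq_card ((Finset.erase_subset a T).trans hT)
    have h3 := Finset.card_erase_add_one ha
    omega
  refine ⟨A', hmem.1, X, hmem.2, fun a ha => ?_, fun x hx => ?_, ?_⟩
  · have := hmax (A'.erase a) X ⟨(Finset.erase_subset a A').trans hmem.1, hmem.2⟩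
    rw [hsd A A' a hmem.1 ha, ← Finset.add_sum_erase A' _ ha] at this
    nlinarith
  · have := hmax A' (X.erase x) ⟨hmem.1, (Finset.erase_subset x X).trans hmem.2⟩
    rw [hsd Y X x hmem.2 hx, sum_card_neighborFinset_inter_comm,
      sum_card_neighborFinset_inter_comm A' X, ← Finset.add_sum_erase X _ hx] at this
    nlinarith
  · have := hmax A Y ⟨le_refl _, le_refl _⟩
    have h1 := Finset.card_le_card (Finset.sdiff_subset (s := A) (t := A'))
    have h2 := Finset.card_le_card (Finset.sdiff_subset (s := Y) (t := X))
    simp only [Finset.sdiff_self, Finset.card_empty] at this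
    nlinarith

/-- The neighbours `A` of `v` and the set `X`, which may intersect `A` but does not contain `v`,
are such that each vertex of one set has at least `c` neighbours in the other. -/
structure IsCore (G : SimpleGraph V) [DecidableRel G.Adj] (v : V) (A X : Finset V) (c : ℕ) :
    Prop where
  adj : ∀ a ∈ A, G.Adj v a
  notMem : v ∉ X
  left : ∀ a ∈ A, c ≤ (G.neighborFinset a ∩ X).card
  right : ∀ x ∈ X, c ≤ (G.neighborFinset x ∩ A).card

variable {v : V} {A X : Finset V} {c : ℕ}

/-- Zigzag between `A` and `X`, then move to the prescribed end through `v`. -/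
theorem IsCore.pathAvoiding_even (h : IsCore G v A X c) (j : ℕ) {F : Finset V} {a w : V}
    (ha : a ∈ A) (hw : w ∈ A) (haw : a ≠ w) (haF : a ∉ F) (hwF : w ∉ F) (hvF : v ∉ F)
    (hcard : F.card + 2 * j + 5 ≤ c) : PathAvoiding G F (2 * j + 2) a w := by
  induction j generalizing F a with
  | zero => exact .two (h.adj a ha).symm (h.adj w hw) haF hvF hwF haw.symm
  | succ j ih =>
    have h1 := h.left a ha
    obtain ⟨x, hx, xa, xw, xF⟩ := exists_mem_notMem_insert₂
      (S := G.neighborFinset a ∩ X) (F := F) (a := a) (b := w) (by omega)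
    simp only [Finset.mem_inter, G.mem_neighborFinset] at hx
    have h2 := h.right x hx.2
    obtain ⟨b, hb, ba, bw, bx, bF⟩ := exists_mem_notMem_insert₃
      (S := G.neighborFinset x ∩ A) (F := F) (a := a) (b := w) (c := x) (by omega)
    simp only [Finset.mem_inter, G.mem_neighborFinset] at hb
    have hc1 := Finset.card_insert_le a F
    have hc2 := Finset.card_insert_le x (insert a F)
    have hvx : v ≠ x := fun hvx => h.notMem (hvx ▸ hx.2)
    exact .cons hx.1 haF (.cons hb.1 (by simp [xa, xF]) (ih hb.2 bw (by simp [bx, ba, bF])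
      (by simp [xw.symm, haw.symm, hwF]) (by simp [hvx, (h.adj a ha).ne, hvF]) (by omega)))

/-- An edge inside `A` starting at `u` changes the parity. -/
theorem IsCore.pathAvoiding_of_adj (h : IsCore G v A X c) (j : ℕ) {u a w : V} (hu : u ∈ A)
    (ha : a ∈ A) (hw : w ∈ A) (hua : G.Adj u a) (haw : a ≠ w) (huw : u ≠ w)
    (hcard : 2 * j + 10 ≤ c) : PathAvoiding G ∅ (2 * j + 3) u w :=
  .cons hua (by simp) (h.pathAvoiding_even j ha hw haw (by simp [hua.ne'])
    (by simp [huw.symm]) (by simp [(h.adj u hu).ne]) (by simp; omega))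

/-- An edge inside `A` at distance two from `u` changes the parity. -/
theorem IsCore.pathAvoiding_of_adj_of_adj (h : IsCore G v A X c) (j : ℕ) {u x a b w : V}
    (hu : u ∈ A) (hx : x ∈ X) (ha : a ∈ A) (hb : b ∈ A) (hw : w ∈ A) (hux : G.Adj u x)
    (hxa : G.Adj x a) (hab : G.Adj a b) (huw : u ≠ w) (hau : a ≠ u) (haw : a ≠ w) (hbu : b ≠ u)
    (hbw : b ≠ w) (hxw : x ≠ w) (hxb : x ≠ b) (hcard : 2 * j + 10 ≤ c) :
    PathAvoiding G ∅ (2 * j + 5) u w := by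
  have hvx : v ≠ x := fun hvx => h.notMem (hvx ▸ hx)
  refine .cons hux (by simp) (.cons hxa (by simp [hux.ne']) (.cons hab (by simp [hxa.ne', hau])
    (h.pathAvoiding_even j hb hw hbw (by simp [hab.ne', hxb.symm, hbu])
      (by simp [haw.symm, hxw.symm, huw.symm])
      (by simp [(h.adj a ha).ne, hvx, (h.adj u hu).ne]) ?_)))
  have := Finset.card_le_three (a := a) (b := x) (c := u)
  simp only [insert_empty_eq]
  omega

end Core

/-! ### Bipartite graphs and `K_{n,n+1}` -/

section CompleteBipartite

variable {V : Type*} [Fintype V] [DecidableEq V] {G : SimpleGraph V} [DecidableRel G.Adj]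

/-- A bipartite graph with parts of sizes `l` and `2 * n + 1 - l` has at most
`l * (2 * n + 1 - l) ≤ n ^ 2 + n` edges. -/
theorem iso_completeBipartiteGraph_of_bipartition {n : ℕ} (hcard : Fintype.card V = 2 * n + 1)
    (hedge : n ^ 2 + n ≤ G.edgeFinset.card) {L : Finset V}
    (hL : ∀ x y, G.Adj x y → (x ∈ L ↔ y ∉ L)) :
    G.edgeFinset.card = n ^ 2 + n ∧
      Nonempty (G ≃g completeBipartiteGraph (Fin n) (Fin (n + 1))) := by
  wlog hn : L.card ≤ n generalizing L
  · refine this (L := Lᶜ) (fun x y h => ?_) ?_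
    · have := hL x y h
      simp only [Finset.mem_compl]
      tauto
    · rw [Finset.card_compl]; omega
  have hLc : Lᶜ.card = 2 * n + 1 - L.card := by rw [Finset.card_compl, hcard]
  have hsum : ∑ z ∈ L, G.degree z = G.edgeFinset.card := by
    have h1 : ∑ z ∈ L, G.degree z = ∑ z ∈ Lᶜ, G.degree z := by
      have e1 : ∀ z ∈ L, G.degree z = (G.neighborFinset z ∩ Lᶜ).card := by
        intro z hz
        rw [← G.card_neighborFinset_eq_degree]
        congr 1
        ext y
        simp only [Finset.mem_inter, G.mem_neighborFinset, Finset.mem_compl]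
        exact ⟨fun h => ⟨h, (hL z y h).1 hz⟩, fun h => h.1⟩
      have e2 : ∀ z ∈ Lᶜ, G.degree z = (G.neighborFinset z ∩ L).card := by
        intro z hz
        rw [Finset.mem_compl] at hz
        rw [← G.card_neighborFinset_eq_degree]
        congr 1
        ext y
        simp only [Finset.mem_inter, G.mem_neighborFinset]
        exact ⟨fun h => ⟨h, by_contra fun hy => hz ((hL z y h).2 hy)⟩, fun h => h.1⟩
      rw [Finset.sum_congr rfl e1, Finset.sum_congr rfl e2, sum_card_neighborFinset_inter_comm]
    have h2 := G.sum_degrees_eq_twice_card_edges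
    rw [← Finset.sum_add_sum_compl L] at h2
    omega
  have hdeg : ∀ z ∈ L, G.neighborFinset z ⊆ Lᶜ := by
    intro z hz y hy
    rw [G.mem_neighborFinset] at hy
    exact Finset.mem_compl.2 ((hL z y hy).1 hz)
  have hdegc : ∀ z ∈ L, G.degree z ≤ Lᶜ.card := fun z hz => by
    rw [← G.card_neighborFinset_eq_degree]
    exact Finset.card_le_card (hdeg z hz)
  have hle := Finset.sum_le_card_nsmul L _ _ hdegc
  rw [hsum, smul_eq_mul, hLc] at hle
  have hLn : L.card = n := by
    obtain ⟨d, hd⟩ : ∃ d, n = L.card + d := ⟨n - L.card, by omega⟩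
    rw [show 2 * n + 1 - L.card = L.card + 2 * d + 1 by omega] at hle
    generalize L.card = l at *
    subst hd
    have : d * d + d ≤ 0 := by nlinarith
    have : d = 0 := by nlinarith
    omega
  rw [hLn, show 2 * n + 1 - n = n + 1 by omega] at hle hLc
  have hE : G.edgeFinset.card = n ^ 2 + n := le_antisymm (by nlinarith) hedge
  refine ⟨hE, ?_⟩
  have hfull : ∀ z ∈ L, ∀ y ∉ L, G.Adj z y := by
    have : ∑ z ∈ L, G.degree z = ∑ z ∈ L, Lᶜ.card := by
      rw [hsum, Finset.sum_const, hE, hLn, hLc, smul_eq_mul]; ring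
    intro z hz y hy
    have h3 := (Finset.sum_eq_sum_iff_of_le hdegc).1 this z hz
    rw [← G.card_neighborFinset_eq_degree] at h3
    have h4 := Finset.eq_of_subset_of_card_le (hdeg z hz) h3.ge
    rw [← G.mem_neighborFinset, h4]
    exact Finset.mem_compl.2 hy
  have c1 : Fintype.card {x // x ∈ L} = n := by simpa using hLn
  have c2 : Fintype.card {x // x ∉ L} = n + 1 := by
    rw [Fintype.card_subtype_compl, hcard, c1]; omega
  let e := (Equiv.sumCompl (· ∈ L)).symm.trans
    (Equiv.sumCongr (Fintype.equivFinOfCardEq c1) (Fintype.equivFinOfCardEq c2))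
  refine ⟨⟨e, ?_⟩⟩
  intro x y
  by_cases hx : x ∈ L <;> by_cases hy : y ∈ L
  · have : ¬ G.Adj x y := fun h => (hL x y h).1 hx hy
    simp [e, hx, hy, this]
  · simp [e, hx, hy, hfull x hx y hy]
  · simp [e, hx, hy, (hfull y hy x hx).symm]
  · have : ¬ G.Adj x y := fun h => hx ((hL x y h).2 hy)
    simp [e, hx, hy, this]

omit [DecidableEq V] in
/-- A path of odd length joins a vertex of degree `n` to a vertex of degree `n + 1`. -/
theorem equalDegreePathFree_of_iso_completeBipartiteGraph {n : ℕ} (ℓ : ℕ)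
    (e : G ≃g completeBipartiteGraph (Fin n) (Fin (n + 1))) :
    G.edgeFinset.card = n ^ 2 + n ∧ EqualDegreePathFree G (2 * ℓ + 1) := by
  have hdeg : ∀ x, G.degree x = if (e x).isRight then n else n + 1 := by
    intro x
    have h1 := Finset.card_map e.toEquiv.toEmbedding (s := G.neighborFinset x)
    rw [G.card_neighborFinset_eq_degree] at h1
    have h2 : ∀ y, y ∈ (G.neighborFinset x).map e.toEquiv.toEmbedding ↔
        (completeBipartiteGraph (Fin n) (Fin (n + 1))).Adj (e x) y := by
      intro y
      obtain ⟨y, rfl⟩ := e.surjective y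
      rw [e.map_adj_iff]
      exact (Finset.mem_map' e.toEquiv.toEmbedding).trans (G.mem_neighborFinset _ _)
    generalize e x = z at *
    rw [← h1]
    rcases z with z | z
    · rw [show (G.neighborFinset x).map e.toEquiv.toEmbedding =
        Finset.univ.map Function.Embedding.inr by
          ext (y | y) <;> rw [h2] <;> simp]
      simp
    · rw [show (G.neighborFinset x).map e.toEquiv.toEmbedding =
        Finset.univ.map Function.Embedding.inl by
          ext (y | y) <;> rw [h2] <;> simp]
      simp
  constructor
  · have h := G.sum_degrees_eq_twice_card_edges
    rw [Fintype.sum_equiv e.toEquiv (fun x => G.degree x)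
      (fun z => if z.isRight then n else n + 1) (fun x => hdeg x), Fintype.sum_sum_type] at h
    simp at h
    nlinarith
  · intro u v huv hd p hp hlen
    have hodd : Odd (p.map e.toHom).length := by
      rw [SimpleGraph.Walk.length_map, hlen]
      exact ⟨ℓ, rfl⟩
    rw [(SimpleGraph.CompleteBipartiteGraph.bicoloring _ _).odd_length_iff_not_congr] at hodd
    change ¬ ((e u).isRight = true) ↔ (e v).isRight = true at hodd
    rw [hdeg, hdeg] at hd
    by_cases hu : (e u).isRight = true <;> by_cases hv : (e v).isRight = true <;> simp_all

end CompleteBipartite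

/-! ### The dichotomy and the extremal graph -/

section Dichotomy

variable {V : Type*} [Fintype V] [DecidableEq V] {G : SimpleGraph V} [DecidableRel G.Adj]

/-- Two vertices of `A` with equal degrees have no neighbours in `A`, except possibly each other. -/
theorem IsCore.eq_of_adj {v : V} {A X : Finset V} {ℓ : ℕ} (h : IsCore G v A X (2 * ℓ + 10))
    (hℓ : 3 ≤ ℓ) (hfree : EqualDegreePathFree G (2 * ℓ + 1)) {u a w : V} (hu : u ∈ A) (ha : a ∈ A)
    (hw : w ∈ A) (huw : u ≠ w) (hdeg : G.degree u = G.degree w) (hua : G.Adj u a) : a = w := by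
  by_contra haw
  have := h.pathAvoiding_of_adj (ℓ - 1) hu ha hw hua haw huw (by omega)
  rw [show 2 * (ℓ - 1) + 3 = 2 * ℓ + 1 by omega] at this
  exact hfree.degree_ne huw this hdeg

theorem degree_le_of_inter_subset_singleton {A : Finset V} {z p : V}
    (h : ∀ y ∈ A, G.Adj z y → y = p) : G.degree z ≤ Aᶜ.card + 1 := by
  have h1 := card_inter_add_card_inter_compl (G := G) z A
  have h2 : (G.neighborFinset z ∩ A).card ≤ 1 := by
    rw [← Finset.card_singleton p]
    refine Finset.card_le_card fun y hy => ?_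
    rw [Finset.mem_inter, G.mem_neighborFinset] at hy
    exact Finset.mem_singleton.2 (h y hy.2 hy.1)
  have h3 := Finset.card_le_card (Finset.inter_subset_right (s₁ := G.neighborFinset z) (s₂ := Aᶜ))
  omega

theorem IsCore.degree_le_of_degree_eq {v : V} {A X : Finset V} {ℓ : ℕ}
    (h : IsCore G v A X (2 * ℓ + 10)) (hℓ : 3 ≤ ℓ) (hfree : EqualDegreePathFree G (2 * ℓ + 1))
    {u w : V} (hu : u ∈ A) (hw : w ∈ A) (huw : u ≠ w) (hdeg : G.degree u = G.degree w) :
    G.degree u ≤ Aᶜ.card + 1 :=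
  degree_le_of_inter_subset_singleton (A := A) (p := w)
    fun _ hy huy => h.eq_of_adj hℓ hfree hu hy hw huw hdeg huy

/-- Let `u` share its degree with a representative `w`. A representative `o` adjacent to a
core neighbour `x ≠ w` of `u` has no neighbour in `A` other than `w`, since such an edge inside `A`
would give an odd path from `u` to `w`. A representative adjacent to a vertex of `A \ P` has a
repeated degree. Every other representative has all its neighbours in `P` or outside `A`, and none
of them is a core neighbour of `u` other than `w`. -/
theorem IsCore.degree_le_of_mem_representatives {v : V} {A X P : Finset V} {ℓ : ℕ}
    (h : IsCore G v A X (2 * ℓ + 10)) (hℓ : 3 ≤ ℓ) (hfree : EqualDegreePathFree G (2 * ℓ + 1))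
    (hPA : P ⊆ A) (hP : ∀ q ∈ A \ P, ∃ p ∈ P, G.degree q = G.degree p)
    {u : V} (hu : u ∈ A \ P) {o : V} (ho : o ∈ P) :
    G.degree o ≤ Aᶜ.card + 1 ∨
      G.degree o + (G.neighborFinset u ∩ X).card ≤ P.card + Aᶜ.card + 1 := by
  obtain ⟨w, hwP, huwd⟩ := hP u hu
  obtain ⟨huA, huP⟩ := Finset.mem_sdiff.1 hu
  have huw : u ≠ w := fun e => huP (e ▸ hwP)
  have hwA := hPA hwP
  have hoA := hPA ho
  have hou : o ≠ u := fun e => huP (e ▸ ho)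
  set Xu := (G.neighborFinset u ∩ X).erase w with hXu
  have hXucard : (G.neighborFinset u ∩ X).card ≤ Xu.card + 1 := by
    have := Finset.pred_card_le_card_erase (s := G.neighborFinset u ∩ X) (a := w)
    rw [hXu]
    omega
  have hXuA : ∀ x ∈ Xu, x ∉ A := by
    intro x hx hxA
    simp only [hXu, Finset.mem_erase, Finset.mem_inter, G.mem_neighborFinset] at hx
    exact hx.1 (h.eq_of_adj hℓ hfree huA hxA hwA huw huwd hx.2.1)
  by_cases hox : ∃ x ∈ Xu, G.Adj o x
  · left
    by_cases how : o = w
    · rw [how, ← huwd]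
      exact h.degree_le_of_degree_eq hℓ hfree huA hwA huw huwd
    obtain ⟨x, hx, hox⟩ := hox
    have hxA := hXuA x hx
    simp only [hXu, Finset.mem_erase, Finset.mem_inter, G.mem_neighborFinset] at hx
    refine degree_le_of_inter_subset_singleton (A := A) (p := w) fun b hb hob => ?_
    by_contra hbw
    have hbu : b ≠ u := by
      rintro rfl
      exact how (h.eq_of_adj hℓ hfree huA hoA hwA huw huwd hob.symm)
    have := h.pathAvoiding_of_adj_of_adj (ℓ - 2) huA hx.2.2 hoA hb hwA hx.2.1 hox.symm hob huw hou
      how hbu hbw hx.1 (fun e => hxA (e ▸ hb)) (by omega)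
    rw [show 2 * (ℓ - 2) + 5 = 2 * ℓ + 1 by omega] at this
    exact hfree.degree_ne huw this huwd
  · push Not at hox
    by_cases hoq : ∃ q ∈ A \ P, G.Adj o q
    · left
      obtain ⟨q, hq, hoq⟩ := hoq
      obtain ⟨p, hpP, hqp⟩ := hP q hq
      obtain ⟨hqA, hqP⟩ := Finset.mem_sdiff.1 hq
      have hqp' : q ≠ p := fun e => hqP (e ▸ hpP)
      rw [h.eq_of_adj hℓ hfree hqA hoA (hPA hpP) hqp' hqp hoq.symm, ← hqp]
      exact h.degree_le_of_degree_eq hℓ hfree hqA (hPA hpP) hqp' hqp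
    · right
      push Not at hoq
      have hsub : G.neighborFinset o ⊆ P ∪ (Aᶜ \ Xu) := by
        intro y hy
        rw [G.mem_neighborFinset] at hy
        by_cases hyA : y ∈ A
        · refine Finset.mem_union_left _ ?_
          by_contra hyP
          exact hoq y (Finset.mem_sdiff.2 ⟨hyA, hyP⟩) hy
        · exact Finset.mem_union_right _ (Finset.mem_sdiff.2
            ⟨Finset.mem_compl.2 hyA, fun hyX => hox y hyX hy⟩)
      have h1 := (Finset.card_le_card hsub).trans (Finset.card_union_le _ _)
      rw [G.card_neighborFinset_eq_degree] at h1
      have h2 := Finset.card_sdiff_add_card_eq_card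
        (show Xu ⊆ Aᶜ from fun x hx => Finset.mem_compl.2 (hXuA x hx))
      omega

/-- The vertices outside the neighbourhood of `v` contribute at most `(N - D) * D` to the degree
sum, where `D` is the degree of `v`, and the vertices in it little more than the number of edges
between the two sides of the core. -/
theorem exists_core_of_maximal_degree (c : ℕ) {v : V} (hv : ∀ z, G.degree z ≤ G.degree v) :
    ∃ A X, IsCore G v A X c ∧ ∑ z, G.degree z ≤ ∑ a ∈ A, (G.neighborFinset a ∩ X).card +
      c * (2 * Fintype.card V) + G.degree v + (Fintype.card V - G.degree v) * G.degree v := by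
  obtain ⟨A, hA, X, hX, h1, h2, h3⟩ := exists_core (G := G) (G.neighborFinset v) {v}ᶜ c
  refine ⟨A, X, ⟨fun a ha => (G.mem_neighborFinset _ _).1 (hA ha), fun hvX => ?_, h1, h2⟩, ?_⟩
  · simpa using hX hvX
  rw [← Finset.sum_add_sum_compl (G.neighborFinset v)]
  have h4 : ∑ z ∈ (G.neighborFinset v)ᶜ, G.degree z ≤
      (Fintype.card V - G.degree v) * G.degree v := by
    rw [← G.card_neighborFinset_eq_degree v, ← Finset.card_compl, ← smul_eq_mul,
      G.card_neighborFinset_eq_degree v]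
    exact Finset.sum_le_card_nsmul _ _ _ fun z _ => hv z
  have h5 : ∑ z ∈ G.neighborFinset v, G.degree z ≤
      ∑ a ∈ G.neighborFinset v, (G.neighborFinset a ∩ {v}ᶜ).card + G.degree v := by
    rw [← G.card_neighborFinset_eq_degree v, Finset.card_eq_sum_ones, ← Finset.sum_add_distrib]
    refine Finset.sum_le_sum fun z _ => ?_
    have h6 := card_inter_add_card_inter_compl (G := G) z {v}
    have h7 := Finset.card_le_card (Finset.inter_subset_right (s₁ := G.neighborFinset z) (s₂ := {v}))
    rw [Finset.card_singleton] at h7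
    omega
  have h8 : c * ((G.neighborFinset v).card + ({v}ᶜ : Finset V).card) ≤ c * (2 * Fintype.card V) := by
    refine Nat.mul_le_mul_left _ ?_
    have := Finset.card_le_univ (G.neighborFinset v)
    have := Finset.card_le_univ ({v}ᶜ : Finset V)
    omega
  omega

/-- Without paths of length `2 * ℓ + 1` between vertices of equal degree, either almost all degrees
are distinct or the graph is close to a balanced complete bipartite graph. -/
theorem injOn_degree_or_nearly_complete {ℓ : ℕ} (hℓ : 3 ≤ ℓ)
    (hfree : EqualDegreePathFree G (2 * ℓ + 1))
    (hcard : 10 ^ 10 * (8 * ℓ + 44) ≤ Fintype.card V)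
    (hedge : Fintype.card V * Fintype.card V ≤ 2 * ∑ z, G.degree z + 1) :
    (∃ P : Finset V, Set.InjOn (fun z => G.degree z) P ∧
      1999 * Fintype.card V ≤ 2000 * P.card) ∨
    (∃ Q B : Finset V, Disjoint Q B ∧ 2499 * (Fintype.card V * Fintype.card V) ≤
      10000 * ∑ z ∈ Q, (G.neighborFinset z ∩ B).card ∧ ∀ q ∈ Q, G.degree q ≤ B.card + 1) := by
  have : Nonempty V := Fintype.card_pos_iff.1 (by omega)
  obtain ⟨v, hv⟩ := G.exists_maximal_degree_vertex
  obtain ⟨A, X, h, hsum⟩ := exists_core_of_maximal_degree (G := G) (2 * ℓ + 10) (v := v)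
    fun z => hv ▸ G.degree_le_maxDegree z
  have hmax : ∀ z, G.degree z ≤ G.degree v := fun z => hv ▸ G.degree_le_maxDegree z
  obtain ⟨P, hPA, hPinj, hPim⟩ : ∃ P ⊆ A, Set.InjOn (fun z => G.degree z) P ∧
      ∀ q ∈ A, ∃ p ∈ P, G.degree q = G.degree p := by
    obtain ⟨P, hPA, hP, him⟩ := Finset.exists_subset_injOn_image_eq_of_surjOn
      (f := fun z => G.degree z) A (A.image fun z => G.degree z) (by
        rw [Finset.coe_image]; exact Set.surjOn_image _ _)
    refine ⟨P, hPA, hP, fun q hq => ?_⟩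
    have := Finset.mem_image_of_mem (fun z => G.degree z) hq
    rw [← him, Finset.mem_image] at this
    obtain ⟨p, hp, hpq⟩ := this
    exact ⟨p, hp, hpq.symm⟩
  by_cases hPlarge : 1999 * Fintype.card V ≤ 2000 * P.card
  · exact .inl ⟨P, hPinj, hPlarge⟩
  right
  have hPim' : ∀ q ∈ A \ P, ∃ p ∈ P, G.degree q = G.degree p :=
    fun q hq => hPim q (Finset.mem_sdiff.1 hq).1
  have hQ : ∀ q ∈ A \ P, G.degree q ≤ Aᶜ.card + 1 := by
    intro q hq
    obtain ⟨p, hpP, hqp⟩ := hPim' q hq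
    obtain ⟨hqA, hqP⟩ := Finset.mem_sdiff.1 hq
    exact h.degree_le_of_degree_eq hℓ hfree hqA (hPA hpP) (fun e => hqP (e ▸ hpP)) hqp
  have hQ1 : ∀ q ∈ A \ P, (G.neighborFinset q ∩ X).card ≤ (G.neighborFinset q ∩ Aᶜ).card + 1 := by
    intro q hq
    obtain ⟨p, hpP, hqp⟩ := hPim' q hq
    obtain ⟨hqA, hqP⟩ := Finset.mem_sdiff.1 hq
    have h1 := card_inter_add_card_inter_compl (G := G) q A
    have h2 : (G.neighborFinset q ∩ A).card ≤ 1 := by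
      rw [← Finset.card_singleton p]
      refine Finset.card_le_card fun y hy => ?_
      rw [Finset.mem_inter, G.mem_neighborFinset] at hy
      exact Finset.mem_singleton.2 (h.eq_of_adj hℓ hfree hqA hy.2 (hPA hpP)
        (fun e => hqP (e ▸ hpP)) hqp hy.1)
    have h3 := Finset.card_le_card (Finset.inter_subset_left (s₁ := G.neighborFinset q) (s₂ := X))
    rw [G.card_neighborFinset_eq_degree] at h3
    omega
  have hsplit : ∑ a ∈ A, (G.neighborFinset a ∩ X).card ≤
      ∑ a ∈ P, G.degree a + ∑ a ∈ A \ P, (G.neighborFinset a ∩ X).card := by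
    rw [← Finset.sum_sdiff hPA, add_comm]
    refine Nat.add_le_add_right (Finset.sum_le_sum fun z _ => ?_) _
    rw [← G.card_neighborFinset_eq_degree]
    exact Finset.card_le_card Finset.inter_subset_left
  have hcardA : (A \ P).card + P.card + Aᶜ.card = Fintype.card V := by
    rw [Finset.card_sdiff_add_card_eq_card hPA, Finset.card_add_card_compl]
  have hdv : G.degree v < Fintype.card V := G.degree_lt_card_verts v
  set σ := ∑ a ∈ A \ P, (G.neighborFinset a ∩ X).card with hσ
  -- `M` bounds the degrees in `P`, and `δ` the numbers of core neighbours of the vertices of `A \ P`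
  obtain ⟨M, δ, hPM, hMv, hσδ, hδ, hM⟩ : ∃ M δ : ℕ, (∀ z ∈ P, G.degree z ≤ M) ∧ M ≤ G.degree v ∧
      σ ≤ (A \ P).card * δ ∧ δ ≤ Aᶜ.card + 1 ∧
      (M ≤ Aᶜ.card + 1 ∨ M + δ ≤ P.card + Aᶜ.card + 1) := by
    rcases (A \ P).eq_empty_or_nonempty with hem | hne
    · refine ⟨G.degree v, 0, fun z _ => hmax z, le_rfl, by simp [hσ, hem], by omega, .inr ?_⟩
      rw [hem, Finset.card_empty] at hcardA
      omega
    · obtain ⟨u, hu, humax⟩ := Finset.exists_max_image (A \ P)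
        (fun a => (G.neighborFinset a ∩ X).card) hne
      have h1 := hQ u hu
      have h2 := Finset.card_le_card (Finset.inter_subset_left (s₁ := G.neighborFinset u) (s₂ := X))
      rw [G.card_neighborFinset_eq_degree] at h2
      refine ⟨min (G.degree v) (max (Aᶜ.card + 1)
        (P.card + Aᶜ.card + 1 - (G.neighborFinset u ∩ X).card)), (G.neighborFinset u ∩ X).card,
        fun z hz => ?_, min_le_left _ _, ?_, by omega, by omega⟩
      · have h3 := hmax z
        have h4 := h.degree_le_of_mem_representatives hℓ hfree hPA hPim' hu hz
        omega
      · rw [← smul_eq_mul]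
        exact Finset.sum_le_card_nsmul _ _ _ humax
  refine ⟨A \ P, Aᶜ, Finset.disjoint_of_subset_left Finset.sdiff_subset disjoint_compl_right,
    ?_, hQ⟩
  have hPsum := sum_le_of_injOn hPinj hPM
  have hσle : σ ≤ ∑ z ∈ A \ P, (G.neighborFinset z ∩ Aᶜ).card + (A \ P).card := by
    rw [Finset.card_eq_sum_ones, ← Finset.sum_add_distrib]
    exact Finset.sum_le_sum hQ1
  have hreal : (24991 / 100000 : ℝ) * (Fintype.card V : ℝ) ^ 2 ≤ (σ : ℝ) := by
    have hsum' : Fintype.card V * Fintype.card V + P.card * P.card ≤ 2 * (P.card * M) + 2 * σ +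
        2 * ((Fintype.card V - G.degree v) * G.degree v) +
        (8 * ℓ + 44) * Fintype.card V := by
      have e : (2 * ℓ + 10) * (2 * Fintype.card V) * 2 + 4 * Fintype.card V =
        (8 * ℓ + 44) * Fintype.card V := by ring
      omega
    have hcN := Nat.mul_le_mul_right (Fintype.card V) hcard
    have hcb : Aᶜ.card = Fintype.card V - (A \ P).card - P.card := by omega
    have hle : (A \ P).card + P.card ≤ Fintype.card V := by omega
    have hN : 10 ^ 10 ≤ Fintype.card V := by omega
    rw [not_le] at hPlarge
    clear_value σ
    generalize Fintype.card V = N at *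
    generalize P.card = p at *
    generalize (A \ P).card = q at *
    generalize Aᶜ.card = b at *
    generalize G.degree v = D at *
    have hb : (b : ℝ) = N - q - p := by
      rw [eq_sub_iff_add_eq, eq_sub_iff_add_eq]
      exact_mod_cast (by omega : b + p + q = N)
    rify [hdv.le] at hsum' hcN hN hσδ hδ hM hMv hle hdv hPlarge
    refine stability_inequality_scaled (N := N) (p := p) (q := q) (δ := δ) (D := D) (M := M)
      (by linarith) (by linarith) hσδ (by linarith) hMv ?_ (by positivity) (by positivity)
      (by linarith) hdv.le (by linarith)
    refine hM.imp (fun h => ?_) (fun h => ?_) <;> linarith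
  have hN : (10 : ℝ) ^ 10 ≤ Fintype.card V := by exact_mod_cast (by omega)
  have hq : ((A \ P).card : ℝ) ≤ Fintype.card V := by exact_mod_cast (by omega)
  rify at hσle ⊢
  nlinarith

end Dichotomy

theorem mainTheorem1 :
    ∃ f : Polynomial ℝ, ∀ ℓ : ℕ, 3 ≤ ℓ → ∀ n : ℕ, f.eval (ℓ : ℝ) ≤ (n : ℝ) →
      ∀ (V : Type*) [Fintype V] [DecidableEq V] (G : SimpleGraph V) [DecidableRel G.Adj],
        Fintype.card V = 2 * n + 1 →
          (n ^ 2 + n ≤ G.edgeFinset.card → EqualDegreePathFree G (2 * ℓ + 1) →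
            G.edgeFinset.card = n ^ 2 + n ∧
              Nonempty (G ≃g completeBipartiteGraph (Fin n) (Fin (n + 1)))) ∧
          (Nonempty (G ≃g completeBipartiteGraph (Fin n) (Fin (n + 1))) →
            G.edgeFinset.card = n ^ 2 + n ∧ EqualDegreePathFree G (2 * ℓ + 1)) := by
  refine ⟨Polynomial.C (10 ^ 12) * Polynomial.X, fun ℓ hℓ n hn V _ _ G _ hV =>
    ⟨fun hedge hfree => ?_, fun ⟨e⟩ => equalDegreePathFree_of_iso_completeBipartiteGraph ℓ e⟩⟩
  have hn' : 10 ^ 12 * ℓ ≤ n := by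
    rw [Polynomial.eval_mul, Polynomial.eval_C, Polynomial.eval_X] at hn
    exact_mod_cast hn
  have hsum : Fintype.card V * Fintype.card V ≤ 2 * ∑ z, G.degree z + 1 := by
    rw [G.sum_degrees_eq_twice_card_edges, hV]
    nlinarith
  obtain ⟨P, hPinj, hP⟩ | ⟨Q, B, hQB, hdense, hdeg⟩ :=
    injOn_degree_or_nearly_complete hℓ hfree (by omega) hsum
  · exact absurd hfree (not_equalDegreePathFree_of_injOn_degree hℓ hPinj hP (by omega) hsum)
  · obtain ⟨L, hL⟩ := exists_bipartition_of_nearly_complete hℓ hQB hdense hdeg (by omega) hsum hfree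
    exact iso_completeBipartiteGraph_of_bipartition hV hedge hL
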